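/- Let $\lambda>-\frac12$, $\mu\ge 0$, $v_{\lambda,\mu}(t)=|t|^{2\mu}(1-t^2)^{\lambda-1/2}$ on $[-1,1]$, and let $L_p(v_{\lambda,\mu})$ be the space of complex-valued measurable functions $f$ on $[-1,1]$ with $\|f\|_{L_p(v_{\lambda,\mu})}=\bigl(\int_{-1}^1|f|^p\,v_{\lambda,\mu}\,dt\bigr)^{1/p}<\infty$. Let $\widetilde C_n=\widetilde C_n^{(\lambda,\mu)}$, $n=0,1,\ldots$, be the orthonormal generalized Gegenbauer polynomials, that is, the polynomials of degree $n$ with positive leading coefficient that are orthonormal with respect to $v_{\lambda,\mu}$ on $[-1,1]$. In terms of the Jacobi polynomials $P_n^{(\alpha,\beta)}$ (normalized by $P_n^{(\alpha,\beta)}(1)=(\alpha+1)_n/n!$) they are $$\widetilde C_{2n}(t)=\Bigl(\tfrac{(2n+\lambda+\mu)\Gamma(n+1)\Gamma(n+\lambda+\mu)}{\Gamma(n+\lambda+\frac12)\Gamma(n+\mu+\frac12)}\Bigr)^{1/2}P_n^{(\lambda-1/2,\,\mu-1/2)}(2t^2-1),$$ $$\widetilde C_{2n+1}(t)=\Bigl(\tfrac{(2n+\lambda+\mu+1)\Gamma(n+1)\Gamma(n+\lambda+\mu+1)}{\Gamma(n+\lambda+\frac12)\Gamma(n+\mu+\frac32)}\Bigr)^{1/2}\,t\,P_n^{(\lambda-1/2,\,\mu+1/2)}(2t^2-1),$$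 where for $n=0$ the product $(\lambda+\mu)\Gamma(\lambda+\mu)$ is read as $\Gamma(\lambda+\mu+1)$. Write $\hat f_n=\int_{-1}^1 f\,\widetilde C_n\,v_{\lambda,\mu}\,dt$, $\sigma=\max(\lambda,\mu)+1$, and $\frac1p+\frac1{p'}=1$. Then there are constants $A_p$, $1<p\le 2$, depending only on $p,\lambda,\mu$, such that the following holds. (a) If $1<p\le 2$ and $f\in L_p(v_{\lambda,\mu})$, then $$\Bigl\{\sum_{n=0}^\infty\Bigl((n+1)^{(\frac1{p'}-\frac1p)\sigma}|\hat f_n|\Bigr)^p\Bigr\}^{1/p}\le A_p\,\|f\|_{L_p(v_{\lambda,\mu})};$$ in particular the series converges. (b) If $2\le q<\infty$ and $\phi:\{0,1,2,\ldots\}\to\mathbb C$ satisfies $$\sum_{n=0}^\infty\Bigl((n+1)^{(\frac1{q'}-\frac1q)\sigma}|\phi(n)|\Bigr)^q<\infty,$$ then the polynomials $\Phi_N=\sum_{n=0}^N\phi(n)\,\widetilde C_n$ converge in $L_q(v_{\lambda,\mu})$, as $N\to\infty$, to a function $f\in L_q(v_{\lambda,\mu})$ with $\hat f_n=\phi(n)$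 for all $n\ge 0$, and $$\|f\|_{L_q(v_{\lambda,\mu})}\le A_{q'}\Bigl\{\sum_{n=0}^\infty\Bigl((n+1)^{(\frac1{q'}-\frac1q)\sigma}|\phi(n)|\Bigr)^q\Bigr\}^{1/q},$$ where $A_{q'}$ is the constant of (a) for $p=q'$. -/

import Mathlib

open MeasureTheory Filter Topology Polynomial

noncomputable section

/-- The Jacobi polynomial `P_n^{(α,β)}` in its standard normalization, i.e.
`((α+1)_n / n!) · ₂F₁(-n, n+α+β+1; α+1; (1-x)/2)`, written without denominators:
`(1/n!) ∑_k binom(n,k) (n+α+β+1)_k (α+k+1)_{n-k} ((x-1)/2)^k`,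
where `(a)_k` is the Pochhammer symbol. -/
def jacobiPoly (α β : ℝ) (n : ℕ) : ℝ[X] :=
  C (1 / (n.factorial : ℝ)) *
    ∑ k ∈ Finset.range (n + 1),
      C ((n.choose k : ℝ) * (ascPochhammer ℝ k).eval ((n : ℝ) + α + β + 1) *
          (ascPochhammer ℝ (n - k)).eval (α + (k : ℝ) + 1)) *
        (C (1 / 2) * (X - 1)) ^ k

/-- The normalizing constant of the orthonormal generalized Gegenbauer polynomial of degree `2n`.
For `n = 0` the product `(λ+μ) Γ(λ+μ)` is written as `Γ(λ+μ+1)`, which is its value, by continuity,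
also in the case `λ + μ = 0`. -/
def gegenbauerCoeffEven (lam mu : ℝ) (n : ℕ) : ℝ :=
  Real.sqrt
    ((if n = 0 then Real.Gamma (lam + mu + 1)
      else (2 * (n : ℝ) + lam + mu) * Real.Gamma ((n : ℝ) + 1) * Real.Gamma ((n : ℝ) + lam + mu)) /
      (Real.Gamma ((n : ℝ) + lam + 1 / 2) * Real.Gamma ((n : ℝ) + mu + 1 / 2)))

/-- The normalizing constant of the orthonormal generalized Gegenbauer polynomial of
degree `2n+1`. -/
def gegenbauerCoeffOdd (lam mu : ℝ) (n : ℕ) : ℝ :=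
  Real.sqrt
    (((2 * (n : ℝ) + lam + mu + 1) * Real.Gamma ((n : ℝ) + 1) *
        Real.Gamma ((n : ℝ) + lam + mu + 1)) /
      (Real.Gamma ((n : ℝ) + lam + 1 / 2) * Real.Gamma ((n : ℝ) + mu + 3 / 2)))

/-- The orthonormal generalized Gegenbauer polynomial of degree `n`. -/
def orthoGegenbauer (lam mu : ℝ) (n : ℕ) : ℝ[X] :=
  if Even n then
    C (gegenbauerCoeffEven lam mu (n / 2)) *
      (jacobiPoly (lam - 1 / 2) (mu - 1 / 2) (n / 2)).comp (2 * X ^ 2 - 1)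
  else
    C (gegenbauerCoeffOdd lam mu (n / 2)) * X *
      (jacobiPoly (lam - 1 / 2) (mu + 1 / 2) (n / 2)).comp (2 * X ^ 2 - 1)

/-- The weight `v_{λ,μ}(t) = |t|^{2μ} (1-t²)^{λ-1/2}`. -/
def gegenbauerWeight (lam mu t : ℝ) : ℝ :=
  |t| ^ (2 * mu) * (1 - t ^ 2) ^ (lam - 1 / 2)

/-- The measure `v_{λ,μ}(t) dt` on `[-1,1]`. The space `L_p(v_{λ,μ})` consists of the functions
`f` with `MemLp f p (gegenbauerMeasure lam mu)`. -/
def gegenbauerMeasure (lam mu : ℝ) : Measure ℝ :=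
  (volume.restrict (Set.Icc (-1 : ℝ) 1)).withDensity
    (fun t => ENNReal.ofReal (gegenbauerWeight lam mu t))

/-- The coefficients `f̂_n = ∫_{-1}^1 f C̃_n v_{λ,μ} dt` of the generalized Gegenbauer
expansion of `f`. -/
def gegenbauerFourierCoeff (lam mu : ℝ) (f : ℝ → ℂ) (n : ℕ) : ℂ :=
  ∫ t, f t * (((orthoGegenbauer lam mu n).eval t : ℝ) : ℂ) ∂(gegenbauerMeasure lam mu)

/-- The polynomial `Φ_N = ∑_{n=0}^N φ(n) C̃_n`. -/
def gegenbauerPartialSum (lam mu : ℝ) (φ : ℕ → ℂ) (N : ℕ) (t : ℝ) : ℂ :=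
  ∑ n ∈ Finset.range (N + 1), φ n * (((orthoGegenbauer lam mu n).eval t : ℝ) : ℂ)

/-- The general term
`((n+1)^{(1/p' - 1/p)(max(λ,μ)+1)} |c_n|)^p` of the weighted `ℓ_p` sum, `1/p + 1/p' = 1`. -/
def hardyLittlewoodTerm (lam mu p : ℝ) (c : ℕ → ℂ) (n : ℕ) : ℝ :=
  (((n : ℝ) + 1) ^ ((1 / p.conjExponent - 1 / p) * (max lam mu + 1)) * ‖c n‖) ^ p

end

/-! The theorem is an instance of Paley's inequality for an orthonormal system with polynomial
growth. Put `τ = max lam mu`, so that `σ = τ + 1`. Two facts about the polynomials suffice: they are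
orthonormal (`integral_orthoGegenbauer_mul`), and on `[-1, 1]` the polynomial of degree `n` is
`O((n+1)^τ)` (`exists_abs_orthoGegenbauer_le`).

With `u = 1 - t²` both facts concern Jacobi polynomials on `[0, 1]`. The growth bound follows from
Sonin's argument: the hypergeometric equation makes a quadratic form in the polynomial and its
derivative attain its maximum at an end point (`shiftedJacobi_sq_add_deriv_sq_le`), and end point
values and norming constants are quotients of Gamma functions. Orthonormality is algebraic: the
weight has Beta moments, and the Chu–Vandermonde identity evaluates the pairing with powers of `1 -
u`.

For part (a), the weighted sum is the `p`-th power of the `L_p` norm of `(n+1)^σ |c_n|` for the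
measure with masses `(n+1)^(-2σ)`, which does not depend on `p` (`paleyTerm_eq`). The map from `f`
to this sequence is of weak type (1,1) by the growth bound and of strong type (2,2) by Bessel.
Marcinkiewicz interpolation, carried out by truncating `f` at each height
(`tsum_weight_ite_lt_le_add`), gives `1 < p < 2`; the case `p = 2` is Bessel itself.

Part (b) is dual: a finite sum `Φ` is tested against `conj Φ · |Φ|^(q-2)`, to which (a) applies with
the conjugate exponent. The resulting bound, applied to blocks of the series, gives convergence by
completeness. -/

/-! ### Rising factorials. -/

theorem ascPochhammer_eval_succ_left (n : ℕ) (x : ℝ) :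
    (ascPochhammer ℝ (n + 1)).eval x = x * (ascPochhammer ℝ n).eval (x + 1) := by
  simp [ascPochhammer_succ_left, eval_comp]

/-- The Chu–Vandermonde identity for rising factorials. -/
theorem sum_neg_one_pow_choose_mul_ascPochhammer (n : ℕ) (b c : ℝ) :
    ∑ k ∈ Finset.range (n + 1), (n.choose k : ℝ) *
      ((-1) ^ k * (ascPochhammer ℝ k).eval b * (ascPochhammer ℝ (n - k)).eval (c + k)) =
      (ascPochhammer ℝ n).eval (c - b) := by
  induction n generalizing c with
  | zero => simp
  | succ n ih =>
    rw [Finset.sum_choose_succ_mul (fun k m => (-1 : ℝ) ^ k * (ascPochhammer ℝ k).eval b *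
      (ascPochhammer ℝ m).eval (c + k)), ascPochhammer_eval_succ_left,
      show c - b + 1 = c + 1 - b by ring, ← ih (c + 1), Finset.mul_sum, ← Finset.sum_add_distrib]
    refine Finset.sum_congr rfl fun k hk => ?_
    have hk : k ≤ n := by simpa [Nat.lt_succ_iff] using hk
    rw [Nat.sub_add_comm hk, ascPochhammer_eval_succ_left, ascPochhammer_succ_eval,
      show c + (k : ℝ) + 1 = c + 1 + k by ring]
    push_cast
    rw [show c + ((k : ℝ) + 1) = c + 1 + k by ring]
    ring

theorem ascPochhammer_eval_mul_Gamma (n : ℕ) {a : ℝ} (ha : 0 < a) :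
    (ascPochhammer ℝ n).eval a * Real.Gamma a = Real.Gamma (a + n) := by
  induction n with
  | zero => simp
  | succ n ih =>
    rw [ascPochhammer_succ_eval, mul_right_comm, ih]
    push_cast
    rw [← add_assoc, Real.Gamma_add_one (by positivity)]
    ring

theorem ascPochhammer_eval_neg_sub (n : ℕ) (c : ℝ) :
    (ascPochhammer ℝ n).eval (-n - c) = (-1) ^ n * (ascPochhammer ℝ n).eval (c + 1) := by
  induction n generalizing c with
  | zero => simp
  | succ n ih =>
    rw [ascPochhammer_eval_succ_left, ascPochhammer_succ_eval]
    have := ih c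
    push_cast
    rw [show -((n : ℝ) + 1) - c + 1 = -n - c by ring, this]
    ring

/-! ### Jacobi polynomials on `[0, 1]`: coefficients, end point values, differential equation. -/

noncomputable section

/-- The coefficient of `u ^ k` in `P_n^{(α,β)}(1 - 2u)`. -/
def jacobiCoeff (α β : ℝ) (n k : ℕ) : ℝ :=
  (n.choose k : ℝ) * ((-1) ^ k * (ascPochhammer ℝ k).eval ((n : ℝ) + α + β + 1) *
    (ascPochhammer ℝ (n - k)).eval (α + 1 + k)) / n.factorial

/-- The Jacobi polynomial transported to `[0, 1]`: `P_n^{(α,β)}(1 - 2u)` as a polynomial in `u`. -/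
def shiftedJacobi (α β : ℝ) (n : ℕ) : ℝ[X] :=
  ∑ k ∈ Finset.range (n + 1), C (jacobiCoeff α β n k) * X ^ k

end

theorem eval_jacobiPoly_one_sub_two_mul (α β : ℝ) (n : ℕ) (u : ℝ) :
    (jacobiPoly α β n).eval (1 - 2 * u) = (shiftedJacobi α β n).eval u := by
  simp only [jacobiPoly, shiftedJacobi, eval_mul, eval_C, eval_finsetSum, eval_pow, eval_sub,
    eval_X, eval_one, Finset.mul_sum, jacobiCoeff]
  refine Finset.sum_congr rfl fun k _ => ?_
  rw [show (1 / 2 : ℝ) * (1 - 2 * u - 1) = -1 * u by ring, mul_pow,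
    show α + (k : ℝ) + 1 = α + 1 + k by ring]
  ring

theorem coeff_shiftedJacobi (α β : ℝ) (n k : ℕ) :
    (shiftedJacobi α β n).coeff k = jacobiCoeff α β n k := by
  simp only [shiftedJacobi, finsetSum_coeff, coeff_C_mul, coeff_X_pow, mul_ite, mul_one, mul_zero]
  rw [Finset.sum_ite_eq]
  split_ifs with h
  · rfl
  · rw [jacobiCoeff, Nat.choose_eq_zero_of_lt (by simpa using h)]
    simp

theorem natDegree_shiftedJacobi_le (α β : ℝ) (n : ℕ) : (shiftedJacobi α β n).natDegree ≤ n := by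
  rw [natDegree_le_iff_coeff_eq_zero]
  intro k hk
  rw [coeff_shiftedJacobi, jacobiCoeff, Nat.choose_eq_zero_of_lt hk]
  simp

/-- This two-term recurrence is the hypergeometric equation read off coefficient by coefficient.
Both sides vanish for `k ≥ n`. -/
theorem jacobiCoeff_succ (α β : ℝ) (n k : ℕ) :
    ((k : ℝ) + 1) * (α + 1 + k) * jacobiCoeff α β n (k + 1) =
      ((k : ℝ) - n) * (k + (n + α + β + 1)) * jacobiCoeff α β n k := by
  rcases lt_trichotomy k n with h | rfl | h
  · obtain ⟨m, rfl⟩ := Nat.exists_eq_add_of_lt h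
    have h1 : ((k + m + 1).choose (k + 1) : ℝ) * (k + 1) = (k + m + 1).choose k * (m + 1) := by
      have := Nat.choose_succ_right_eq (k + m + 1) k
      rw [show k + m + 1 - k = m + 1 by omega] at this
      exact_mod_cast this
    simp only [jacobiCoeff]
    rw [show k + m + 1 - (k + 1) = m by omega, show k + m + 1 - k = m + 1 by omega,
      ascPochhammer_eval_succ_left m, ascPochhammer_succ_eval k]
    push_cast
    rw [show α + 1 + ((k : ℝ) + 1) = α + 1 + k + 1 by ring]
    linear_combination (-(-1) ^ k * (α + 1 + k) * eval (↑k + ↑m + 1 + α + β + 1) (ascPochhammer ℝ k) *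
      (↑k + ↑m + 1 + α + β + 1 + ↑k) * eval (α + 1 + ↑k + 1) (ascPochhammer ℝ m) /
        (k + m + 1).factorial) * h1
  · simp [jacobiCoeff]
  · simp [jacobiCoeff, Nat.choose_eq_zero_of_lt h, Nat.choose_eq_zero_of_lt (h.trans k.lt_succ_self)]

theorem shiftedJacobi_eval_zero (α β : ℝ) (n : ℕ) :
    (shiftedJacobi α β n).eval 0 = (ascPochhammer ℝ n).eval (α + 1) / n.factorial := by
  rw [← coeff_zero_eq_eval_zero, coeff_shiftedJacobi]
  simp [jacobiCoeff]

/-- At `u = 1` the coefficients form a Chu–Vandermonde sum with value `(-n - β)_n`, and reflection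
turns this into `(-1)^n (β + 1)_n`. -/
theorem shiftedJacobi_eval_one (α β : ℝ) (n : ℕ) :
    (shiftedJacobi α β n).eval 1 =
      (-1) ^ n * (ascPochhammer ℝ n).eval (β + 1) / n.factorial := by
  rw [← ascPochhammer_eval_neg_sub, show -(n : ℝ) - β = (α + 1) - (n + α + β + 1) by ring,
    ← sum_neg_one_pow_choose_mul_ascPochhammer, Finset.sum_div]
  simp [shiftedJacobi, eval_finsetSum, jacobiCoeff]

/-- The hypergeometric differential equation. -/
theorem shiftedJacobi_ode (α β : ℝ) (n : ℕ) :
    X * (1 - X) * derivative (derivative (shiftedJacobi α β n)) +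
      (C (α + 1) - C (α + β + 2) * X) * derivative (shiftedJacobi α β n) +
      C (n * (n + α + β + 1)) * shiftedJacobi α β n = 0 := by
  ext k
  have h := jacobiCoeff_succ α β n k
  rw [← coeff_shiftedJacobi, ← coeff_shiftedJacobi] at h
  set E := shiftedJacobi α β n
  rw [show X * (1 - X) * derivative (derivative E) + (C (α + 1) - C (α + β + 2) * X) * derivative E +
      C (n * (n + α + β + 1)) * E = X * derivative (derivative E) -
        X * (X * derivative (derivative E)) + C (α + 1) * derivative E -
        C (α + β + 2) * (X * derivative E) + C (n * (n + α + β + 1)) * E by ring]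
  simp only [coeff_add, coeff_sub, coeff_C_mul, coeff_zero]
  rcases k with _ | _ | k
  · simp [coeff_derivative] at h ⊢
    linear_combination h
  · simp [coeff_derivative, coeff_X_mul] at h ⊢
    linear_combination h
  · simp only [coeff_X_mul, coeff_derivative] at h ⊢
    push_cast at h ⊢
    linear_combination h

/-- Raising the second parameter. -/
theorem shiftedJacobi_add_one_right (α β : ℝ) (n : ℕ) :
    C (n + α + β + 1) * shiftedJacobi α (β + 1) n =
      C (n + α + β + 1) * shiftedJacobi α β n + X * derivative (shiftedJacobi α β n) := by
  ext k
  have h : (X * derivative (shiftedJacobi α β n)).coeff k = k * (shiftedJacobi α β n).coeff k := by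
    rcases k with _ | k
    · simp
    · rw [coeff_X_mul, coeff_derivative]
      push_cast
      ring
  rw [coeff_add, h, coeff_C_mul, coeff_C_mul, coeff_shiftedJacobi, coeff_shiftedJacobi]
  have h2 : ((n : ℝ) + α + β + 1) * (ascPochhammer ℝ k).eval (n + α + (β + 1) + 1) =
      (n + α + β + 1 + k) * (ascPochhammer ℝ k).eval (n + α + β + 1) := by
    rw [show (n : ℝ) + α + (β + 1) + 1 = n + α + β + 1 + 1 by ring, ← ascPochhammer_eval_succ_left,
      ascPochhammer_succ_eval]
    ring
  simp only [jacobiCoeff]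
  linear_combination (n.choose k * (-1) ^ k * (ascPochhammer ℝ (n - k)).eval (α + 1 + k) /
    n.factorial) * h2

/-! ### Growth of Gamma quotients. -/

theorem tendsto_Gamma_nat_add_div {a : ℝ} (ha : 0 < a) :
    Tendsto (fun n : ℕ => Real.Gamma (n + a) / (((n : ℝ) + 1) ^ (a - 1) * n.factorial))
      atTop (𝓝 1) := by
  have hG := Real.Gamma_pos_of_pos ha
  have h1 : Tendsto (fun n : ℕ => Real.GammaSeq a (n + 1)) atTop (𝓝 (Real.Gamma a)) :=
    (Real.GammaSeq_tendsto_Gamma a).comp (tendsto_add_atTop_nat 1)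
  have h2 : Tendsto (fun n : ℕ => ((1 : ℝ) + 1 * n) / ((a + 1) + 1 * n)) atTop (𝓝 (1 / 1)) :=
    tendsto_add_mul_div_add_mul_atTop_nhds _ _ _ one_ne_zero
  have h3 : Tendsto (fun n : ℕ => ((1 : ℝ) + 1 * n) / (a + 1 * n)) atTop (𝓝 (1 / 1)) :=
    tendsto_add_mul_div_add_mul_atTop_nhds _ _ _ one_ne_zero
  -- Euler's product at `n + 1` contains `(a)_(n+2)`, while `Γ(n + a)` supplies only `(a)_n`. The
  -- two fractions tending to 1 remove the surplus factors `a + n` and `a + n + 1`.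
  have h4 := (((tendsto_const_nhds (x := Real.Gamma a)).div h1 hG.ne').mul h2).mul h3
  rw [div_self hG.ne', div_one, mul_one, mul_one] at h4
  refine h4.congr fun n => ?_
  have hprod : ∀ m : ℕ, ∏ j ∈ Finset.range m, (a + j) = (ascPochhammer ℝ m).eval a := by
    intro m
    induction m with
    | zero => simp
    | succ m ih => rw [Finset.prod_range_succ, ih, ascPochhammer_succ_eval]
  have hg := ascPochhammer_eval_mul_Gamma n ha
  have hn : (0 : ℝ) < n + 1 := by positivity
  have hp := Real.rpow_pos_of_pos hn (a - 1)
  have hpo := ascPochhammer_pos n a ha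
  have e1 : ((n : ℝ) + 1) ^ a = ((n : ℝ) + 1) ^ (a - 1) * (n + 1) := by
    rw [← Real.rpow_add_one hn.ne', sub_add_cancel]
  simp only [Real.GammaSeq, Pi.div_apply]
  rw [hprod, ascPochhammer_succ_eval, ascPochhammer_succ_eval, add_comm (n : ℝ) a,
    ← hg, Nat.factorial_succ]
  push_cast
  rw [e1]
  have hf : (0 : ℝ) < n.factorial := by positivity
  have h5 : a + (n : ℝ) ≠ 0 := by positivity
  have h6 : a + ((n : ℝ) + 1) ≠ 0 := by positivity
  have h7 : a + 1 + 1 * (n : ℝ) ≠ 0 := by positivity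
  have h8 : a + 1 * (n : ℝ) ≠ 0 := by positivity
  field_simp
  ring

theorem exists_Gamma_nat_add_le {a : ℝ} (ha : 0 < a) :
    ∃ C > 0, ∀ n : ℕ, Real.Gamma (n + a) ≤ C * (((n : ℝ) + 1) ^ (a - 1) * n.factorial) := by
  obtain ⟨C, hC⟩ := (tendsto_Gamma_nat_add_div ha).bddAbove_range
  refine ⟨max C 1, by positivity, fun n => ?_⟩
  have hn : (0 : ℝ) < n + 1 := by positivity
  rw [← div_le_iff₀ (by positivity)]
  exact (hC ⟨n, rfl⟩).trans (le_max_left _ _)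

theorem exists_le_Gamma_nat_add {a : ℝ} (ha : 0 < a) :
    ∃ c > 0, ∀ n : ℕ, c * (((n : ℝ) + 1) ^ (a - 1) * n.factorial) ≤ Real.Gamma (n + a) := by
  obtain ⟨C, hC⟩ := ((tendsto_Gamma_nat_add_div ha).inv₀ one_ne_zero).bddAbove_range
  refine ⟨(max C 1)⁻¹, by positivity, fun n => ?_⟩
  have hn : (0 : ℝ) < n + 1 := by positivity
  have hG : 0 < Real.Gamma (n + a) := Real.Gamma_pos_of_pos (by positivity)
  have := (hC ⟨n, rfl⟩).trans (le_max_left C 1)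
  simp only [inv_div] at this
  rw [div_le_iff₀ hG] at this
  rw [inv_mul_le_iff₀ (by positivity)]
  exact this

/-- Each `Γ(n + x)` is comparable to `(n+1)^(x-1) n!`, so equal parameter sums make all powers
cancel. -/
theorem exists_Gamma_ratio_le {a b c d : ℝ} (ha : 0 < a) (hb : 0 < b) (hc : 0 < c) (hd : 0 < d)
    (h : a + b = c + d) :
    ∃ C > 0, ∀ n : ℕ, Real.Gamma (n + a) * Real.Gamma (n + b) /
      (Real.Gamma (n + c) * Real.Gamma (n + d)) ≤ C := by
  obtain ⟨A, hA, hA'⟩ := exists_Gamma_nat_add_le ha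
  obtain ⟨B, hB, hB'⟩ := exists_Gamma_nat_add_le hb
  obtain ⟨K, hK, hK'⟩ := exists_le_Gamma_nat_add hc
  obtain ⟨D, hD, hD'⟩ := exists_le_Gamma_nat_add hd
  refine ⟨A * B / (K * D), by positivity, fun n => ?_⟩
  have hn : (0 : ℝ) < n + 1 := by positivity
  have hG : ∀ {x : ℝ}, 0 < x → 0 < Real.Gamma (n + x) := fun hx =>
    Real.Gamma_pos_of_pos (by positivity)
  have := hG ha
  have := hG hb
  have := hG hc
  have := hG hd
  have e : ((n : ℝ) + 1) ^ (a - 1) * ((n : ℝ) + 1) ^ (b - 1) =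
      ((n : ℝ) + 1) ^ (c - 1) * ((n : ℝ) + 1) ^ (d - 1) := by
    rw [← Real.rpow_add hn, ← Real.rpow_add hn]
    congr 1
    linarith
  have hp : ∀ x : ℝ, 0 < ((n : ℝ) + 1) ^ x := fun x => Real.rpow_pos_of_pos hn x
  have h1 := hp (a - 1)
  have h2 := hp (b - 1)
  have h3 := hp (c - 1)
  have h4 := hp (d - 1)
  calc _ ≤ (A * (((n : ℝ) + 1) ^ (a - 1) * n.factorial)) * (B * (((n : ℝ) + 1) ^ (b - 1) * n.factorial))
        / ((K * (((n : ℝ) + 1) ^ (c - 1) * n.factorial)) *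
          (D * (((n : ℝ) + 1) ^ (d - 1) * n.factorial))) := by
        gcongr
        · exact hA' n
        · exact hB' n
        · exact hK' n
        · exact hD' n
    _ = A * B * (((n : ℝ) + 1) ^ (a - 1) * ((n : ℝ) + 1) ^ (b - 1)) /
          (K * D * (((n : ℝ) + 1) ^ (c - 1) * ((n : ℝ) + 1) ^ (d - 1))) := by
        field_simp
    _ = A * B / (K * D) := by
        rw [e]
        field_simp

theorem exists_sq_ascPochhammer_div_factorial_le {a : ℝ} (ha : 0 < a) :
    ∃ C > 0, ∀ n : ℕ, ((ascPochhammer ℝ n).eval a / n.factorial) ^ 2 ≤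
      C * ((n : ℝ) + 1) ^ (2 * (a - 1)) := by
  obtain ⟨A, hA, hA'⟩ := exists_Gamma_nat_add_le ha
  have hG := Real.Gamma_pos_of_pos ha
  refine ⟨(A / Real.Gamma a) ^ 2, by positivity, fun n => ?_⟩
  have hn : (0 : ℝ) < n + 1 := by positivity
  have hpo := ascPochhammer_pos n a ha
  rw [mul_comm 2 (a - 1), Real.rpow_mul hn.le, Real.rpow_two, ← mul_pow]
  gcongr
  rw [div_le_iff₀ (by positivity), div_mul_eq_mul_div, div_mul_eq_mul_div, le_div_iff₀ hG,
    ascPochhammer_eval_mul_Gamma n ha, add_comm, mul_assoc]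
  exact hA' n

/-! ### Uniform bounds for the orthonormal polynomials. -/

/-- The Sonin-type estimate: the function on the left has its maximum at an end point. -/
theorem shiftedJacobi_sq_add_deriv_sq_le {α β : ℝ} {n : ℕ} (hn : 0 < (n : ℝ) * (n + α + β + 1))
    (hβ : -(1 / 2) ≤ β) {u : ℝ} (hu : u ∈ Set.Icc (0 : ℝ) 1) :
    (shiftedJacobi α β n).eval u ^ 2 +
      u * (1 - u) * (derivative (shiftedJacobi α β n)).eval u ^ 2 / (n * (n + α + β + 1)) ≤
      (shiftedJacobi α β n).eval 0 ^ 2 + (shiftedJacobi α β n).eval 1 ^ 2 := by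
  have ode : ∀ x : ℝ, _ := fun x => congrArg (eval x) (shiftedJacobi_ode α β n)
  set E := shiftedJacobi α β n
  set c := (n : ℝ) * (n + α + β + 1)
  simp only [eval_add, eval_mul, eval_sub, eval_X, eval_C, eval_one, eval_zero] at ode
  let F : ℝ → ℝ := fun x => E.eval x ^ 2 + x * (1 - x) * (derivative E).eval x ^ 2 / c
  -- By the differential equation the derivative of `F` is `E'² l / c` with `l` affine. Since `l 1 =
  -- 2β + 1 ≥ 0`, `l` can change sign on `[0, 1]` only from negative to positive, so `F u` is at
  -- most `F 1` or at most `F 0` according to the sign of `l u`.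
  let l : ℝ → ℝ := fun x => -(2 * α + 1) + 2 * (α + β + 1) * x
  have hF : ∀ x, HasDerivAt F ((derivative E).eval x ^ 2 * l x / c) x := by
    intro x
    have h1 := (E.hasDerivAt x).pow 2
    have h2 := (((hasDerivAt_id x).mul ((hasDerivAt_id x).const_sub 1)).mul
      (((derivative E).hasDerivAt x).pow 2)).div_const c
    convert! h1.add h2 using 1
    simp only [id, l, Pi.mul_apply, Pi.pow_apply]
    field_simp
    push_cast
    linear_combination (-2 * (derivative E).eval x) * ode x
  have hFc : Continuous F := continuous_iff_continuousAt.2 fun x => (hF x).continuousAt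
  have hE0 := sq_nonneg (E.eval 0)
  have hE1 := sq_nonneg (E.eval 1)
  have hF0 : F 0 = E.eval 0 ^ 2 := by simp [F]
  have hF1 : F 1 = E.eval 1 ^ 2 := by simp [F]
  change F u ≤ _
  rcases le_or_gt 0 (l u) with hl | hl
  · have : MonotoneOn F (Set.Icc u 1) := by
      refine monotoneOn_of_deriv_nonneg (convex_Icc _ _) hFc.continuousOn
        (fun x _ => (hF x).differentiableAt.differentiableWithinAt) fun x hx => ?_
      rw [interior_Icc] at hx
      rw [(hF x).deriv]
      have : 0 ≤ l x := by
        -- Affine interpolation of `l` at `x` between `u` and `1`.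
        have h1 : (1 - u) * l x = (1 - x) * l u + (x - u) * (2 * β + 1) := by
          simp only [l]; ring
        have h2 : 0 ≤ (1 - u) * l x := by
          rw [h1]
          have := mul_nonneg (sub_nonneg.2 hx.2.le) hl
          have := mul_nonneg (sub_nonneg.2 hx.1.le) (show 0 ≤ 2 * β + 1 by linarith)
          linarith
        exact nonneg_of_mul_nonneg_right h2 (by linarith [hx.1, hx.2])
      positivity
    have := this (Set.left_mem_Icc.2 hu.2) (Set.right_mem_Icc.2 hu.2) hu.2
    linarith
  · have : AntitoneOn F (Set.Icc 0 u) := by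
      refine antitoneOn_of_deriv_nonpos (convex_Icc _ _) hFc.continuousOn
        (fun x _ => (hF x).differentiableAt.differentiableWithinAt) fun x hx => ?_
      rw [interior_Icc] at hx
      rw [(hF x).deriv]
      have : l x ≤ 0 := by
        have h1 : (1 - u) * l x = (1 - x) * l u + (x - u) * (2 * β + 1) := by
          simp only [l]; ring
        have hu1 : u < 1 := by
          rcases hu.2.lt_or_eq with h | h
          · exact h
          · exfalso
            simp only [l, h] at hl
            linarith
        have h2 : (1 - u) * l x ≤ 0 := by
          rw [h1]
          have := mul_nonneg (show 0 ≤ 1 - x by linarith [hx.2]) (neg_nonneg.2 hl.le)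
          have := mul_nonneg (sub_nonneg.2 hx.2.le) (show 0 ≤ 2 * β + 1 by linarith)
          linarith
        by_contra! h3
        have := mul_pos (sub_pos.2 hu1) h3
        linarith
      exact div_nonpos_of_nonpos_of_nonneg (mul_nonpos_of_nonneg_of_nonpos (sq_nonneg _) this) hn.le
    have := this (Set.left_mem_Icc.2 hu.1) (Set.right_mem_Icc.2 hu.1) hu.1
    linarith

theorem sq_sqrt_le {x y : ℝ} (hy : 0 ≤ y) (h : x ≤ y) : Real.sqrt x ^ 2 ≤ y := by
  calc Real.sqrt x ^ 2 ≤ Real.sqrt y ^ 2 := by gcongr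
    _ = y := Real.sq_sqrt hy

theorem exists_sq_gegenbauerCoeffEven_le {lam mu : ℝ} (hlam : -(1 / 2) < lam) (hmu : 0 ≤ mu) :
    ∃ C > 0, ∀ k : ℕ, gegenbauerCoeffEven lam mu k ^ 2 ≤ C * ((k : ℝ) + 1) := by
  -- The parameters are those of index `k + 1`; index 0, defined by a separate formula, is absorbed
  -- into the maximum below. The Gamma quotient is bounded, and the remaining linear factor gives
  -- the growth.
  obtain ⟨C, hC, hC'⟩ := exists_Gamma_ratio_le (a := 2) (b := 1 + lam + mu) (c := lam + 3 / 2)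
    (d := mu + 3 / 2) (by norm_num) (by linarith) (by linarith) (by linarith) (by ring)
  refine ⟨max (gegenbauerCoeffEven lam mu 0 ^ 2) ((3 + lam + mu) * C),
    lt_max_of_lt_right (mul_pos (by linarith) hC), fun k => ?_⟩
  rcases k with _ | k
  · simp
  refine le_trans ?_ (mul_le_mul_of_nonneg_right (le_max_right _ _) (by positivity))
  have h2 : 0 < 3 + lam + mu := by linarith
  rw [gegenbauerCoeffEven, if_neg k.succ_ne_zero]
  refine sq_sqrt_le (by positivity) ?_
  have h := hC' k
  push_cast
  rw [show (k : ℝ) + 1 + 1 = k + 2 by ring, show (k : ℝ) + 1 + lam + mu = k + (1 + lam + mu) by ring,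
    show (k : ℝ) + 1 + lam + 1 / 2 = k + (lam + 3 / 2) by ring,
    show (k : ℝ) + 1 + mu + 1 / 2 = k + (mu + 3 / 2) by ring, mul_assoc, mul_div_assoc]
  have h3 : 2 * ((k : ℝ) + 1) + lam + mu ≤ (3 + lam + mu) * (k + 2) := by
    have := mul_nonneg (show 0 ≤ lam + mu + 1 by linarith) (Nat.cast_nonneg (α := ℝ) k)
    nlinarith
  have hG : ∀ {x : ℝ}, 0 < x → 0 < Real.Gamma (k + x) := fun hx =>
    Real.Gamma_pos_of_pos (by positivity)
  have := hG (show 0 < lam + 3 / 2 by linarith)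
  have := hG (show 0 < mu + 3 / 2 by linarith)
  have := hG (show 0 < 1 + lam + mu by linarith)
  have := hG (show (0 : ℝ) < 2 by norm_num)
  calc _ ≤ (3 + lam + mu) * (k + 2) * C := by gcongr
    _ = _ := by ring

theorem exists_sq_gegenbauerCoeffOdd_le {lam mu : ℝ} (hlam : -(1 / 2) < lam) (hmu : 0 ≤ mu) :
    ∃ C > 0, ∀ k : ℕ, gegenbauerCoeffOdd lam mu k ^ 2 ≤ C * ((k : ℝ) + 1) := by
  obtain ⟨C, hC, hC'⟩ := exists_Gamma_ratio_le (a := 1) (b := lam + mu + 1) (c := lam + 1 / 2)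
    (d := mu + 3 / 2) (by norm_num) (by linarith) (by linarith) (by linarith) (by ring)
  refine ⟨(3 + lam + mu) * C, mul_pos (by linarith) hC, fun k => ?_⟩
  have h2 : 0 < 3 + lam + mu := by linarith
  refine sq_sqrt_le (by positivity) ?_
  have h := hC' k
  rw [add_assoc (k : ℝ) lam (1 / 2), add_assoc (k : ℝ) mu, mul_assoc, mul_div_assoc,
    show (k : ℝ) + lam + mu + 1 = k + (lam + mu + 1) by ring]
  have h3 : 2 * (k : ℝ) + lam + mu + 1 ≤ (3 + lam + mu) * (k + 1) := by
    have := mul_nonneg (show 0 ≤ lam + mu + 1 by linarith) (Nat.cast_nonneg (α := ℝ) k)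
    nlinarith
  have hG : ∀ {x : ℝ}, 0 < x → 0 < Real.Gamma (k + x) := fun hx =>
    Real.Gamma_pos_of_pos (by positivity)
  have := hG (show 0 < lam + 1 / 2 by linarith)
  have := hG (show 0 < mu + 3 / 2 by linarith)
  have := hG (show 0 < lam + mu + 1 by linarith)
  have := hG (show (0 : ℝ) < 1 by norm_num)
  calc _ ≤ (3 + lam + mu) * (k + 1) * C := by gcongr
    _ = _ := by ring

theorem sq_shiftedJacobi_le {α β : ℝ} (hβ : -(1 / 2) ≤ β) (hαβ : -1 < α + β + 1) (n : ℕ) {u : ℝ}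
    (hu : u ∈ Set.Icc (0 : ℝ) 1) :
    (shiftedJacobi α β n).eval u ^ 2 ≤
      (shiftedJacobi α β n).eval 0 ^ 2 + (shiftedJacobi α β n).eval 1 ^ 2 := by
  rcases n with _ | n
  · simp [shiftedJacobi, jacobiCoeff]
  have hb : 0 < ((n + 1 : ℕ) : ℝ) + α + β + 1 := by
    push_cast
    have := Nat.cast_nonneg (α := ℝ) n
    linarith
  have hn : 0 < ((n + 1 : ℕ) : ℝ) * ((n + 1 : ℕ) + α + β + 1) := by positivity
  refine le_trans ?_ (shiftedJacobi_sq_add_deriv_sq_le hn hβ hu)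
  have := mul_nonneg hu.1 (sub_nonneg.2 hu.2)
  have : 0 ≤ u * (1 - u) * (derivative (shiftedJacobi α β (n + 1))).eval u ^ 2 /
    (((n + 1 : ℕ) : ℝ) * ((n + 1 : ℕ) + α + β + 1)) := by positivity
  linarith

/-- This serves the odd degrees, where `1 - u = t²`. Raising `β` adds `u E' / (n + α + β + 1)`, and
the derivative term of the Sonin form controls precisely `u (1 - u) E'²`. The bound thus uses end
point values for `β` rather than `β + 1`, which keeps the exponent `max lam mu` for odd degrees. -/
theorem one_sub_mul_sq_shiftedJacobi_add_one_right_le {α β : ℝ} (hβ : -(1 / 2) ≤ β)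
    (hαβ : -(1 / 2) < α + β + 1) (n : ℕ) {u : ℝ} (hu : u ∈ Set.Icc (0 : ℝ) 1) :
    (1 - u) * (shiftedJacobi α (β + 1) n).eval u ^ 2 ≤
      4 * ((shiftedJacobi α β n).eval 0 ^ 2 + (shiftedJacobi α β n).eval 1 ^ 2) := by
  have hu1 := sub_nonneg.2 hu.2
  rcases n with _ | n
  · simp [shiftedJacobi, jacobiCoeff]
    linarith [hu.1]
  have hn' := Nat.cast_nonneg (α := ℝ) n
  have hb : 0 < ((n + 1 : ℕ) : ℝ) + α + β + 1 := by
    push_cast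
    linarith
  have hn : 0 < ((n + 1 : ℕ) : ℝ) * ((n + 1 : ℕ) + α + β + 1) := by positivity
  have h1 := shiftedJacobi_sq_add_deriv_sq_le hn hβ hu
  have h2 := congrArg (eval u) (shiftedJacobi_add_one_right α β (n + 1))
  -- Here the degree is at least 1 and `α + β + 1 > -1/2`.
  have hk : ((n + 1 : ℕ) : ℝ) ≤ 2 * ((n + 1 : ℕ) + α + β + 1) := by
    push_cast
    linarith
  have hk0 : (0 : ℝ) < (n + 1 : ℕ) := by positivity
  simp only [eval_add, eval_mul, eval_C, eval_X] at h2
  set E := shiftedJacobi α β (n + 1)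
  set b := ((n + 1 : ℕ) : ℝ) + α + β + 1
  set k := ((n + 1 : ℕ) : ℝ)
  set y := E.eval u
  set d := (derivative E).eval u
  have h3 : (shiftedJacobi α (β + 1) (n + 1)).eval u = y + u * d / b := by
    field_simp
    linear_combination h2
  rw [h3]
  have h4 : (1 - u) * (u * d / b) ^ 2 ≤ 2 * (u * (1 - u) * d ^ 2 / (k * b)) := by
    rw [show (1 - u) * (u * d / b) ^ 2 = u * (k / b) * (u * (1 - u) * d ^ 2 / (k * b)) by
      field_simp]
    have : k / b ≤ 2 := by rwa [div_le_iff₀ hb]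
    have := hu.1
    gcongr
    calc u * (k / b) ≤ 1 * 2 := by
          gcongr
          exact hu.2
      _ = 2 := one_mul 2
  have h5 : (1 - u) * y ^ 2 ≤ 1 * y ^ 2 := by
    gcongr
    linarith [hu.1]
  have h6 : (1 - u) * (y + u * d / b) ^ 2 ≤ 2 * ((1 - u) * y ^ 2) + 2 * ((1 - u) * (u * d / b) ^ 2) := by
    have := mul_nonneg hu1 (sq_nonneg (y - u * d / b))
    linarith
  have := sq_nonneg y
  linarith

/-- The squared end point values have orders `k^(2 lam - 1)` and `k^(2 mu - 1)`; the larger exponent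
wins. -/
theorem exists_endpoint_bound {lam mu : ℝ} (hlam : -(1 / 2) < lam) (hmu : 0 ≤ mu) :
    ∃ K > 0, ∀ k : ℕ, (shiftedJacobi (lam - 1 / 2) (mu - 1 / 2) k).eval 0 ^ 2 +
      (shiftedJacobi (lam - 1 / 2) (mu - 1 / 2) k).eval 1 ^ 2 ≤
        K * ((k : ℝ) + 1) ^ (2 * max lam mu - 1) := by
  obtain ⟨A, hA, hA'⟩ := exists_sq_ascPochhammer_div_factorial_le (a := lam - 1 / 2 + 1) (by linarith)
  obtain ⟨B, hB, hB'⟩ := exists_sq_ascPochhammer_div_factorial_le (a := mu - 1 / 2 + 1) (by linarith)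
  refine ⟨A + B, by positivity, fun k => ?_⟩
  rw [shiftedJacobi_eval_zero, shiftedJacobi_eval_one, mul_div_assoc, mul_pow, ← pow_mul, mul_comm k,
    pow_mul, neg_one_sq, one_pow, one_mul, add_mul]
  have hk : (1 : ℝ) ≤ k + 1 := by simp
  refine add_le_add ((hA' k).trans ?_) ((hB' k).trans ?_) <;> gcongr ?_ * ?_
  · exact Real.rpow_le_rpow_of_exponent_le hk (by linarith [le_max_left lam mu])
  · exact Real.rpow_le_rpow_of_exponent_le hk (by linarith [le_max_right lam mu])

theorem eval_orthoGegenbauer_even (lam mu : ℝ) (k : ℕ) (t : ℝ) :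
    (orthoGegenbauer lam mu (2 * k)).eval t = gegenbauerCoeffEven lam mu k *
      (shiftedJacobi (lam - 1 / 2) (mu - 1 / 2) k).eval (1 - t ^ 2) := by
  rw [orthoGegenbauer, if_pos (even_two_mul k), Nat.mul_div_cancel_left k two_pos,
    ← eval_jacobiPoly_one_sub_two_mul]
  simp only [eval_mul, eval_C, eval_comp, eval_sub, eval_pow, eval_X, eval_one, eval_ofNat]
  ring_nf

theorem eval_orthoGegenbauer_odd (lam mu : ℝ) (k : ℕ) (t : ℝ) :
    (orthoGegenbauer lam mu (2 * k + 1)).eval t = gegenbauerCoeffOdd lam mu k *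
      (t * (shiftedJacobi (lam - 1 / 2) (mu - 1 / 2 + 1) k).eval (1 - t ^ 2)) := by
  rw [orthoGegenbauer, if_neg (by simp), show (2 * k + 1) / 2 = k by omega,
    ← eval_jacobiPoly_one_sub_two_mul]
  simp only [eval_mul, eval_C, eval_comp, eval_sub, eval_pow, eval_X, eval_one, eval_ofNat]
  ring_nf

theorem one_sub_sq_mem_Icc {t : ℝ} (ht : t ∈ Set.Icc (-1 : ℝ) 1) :
    1 - t ^ 2 ∈ Set.Icc (0 : ℝ) 1 :=
  ⟨by nlinarith [ht.1, ht.2], by nlinarith⟩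

theorem exists_abs_orthoGegenbauer_le {lam mu : ℝ} (hlam : -(1 / 2) < lam) (hmu : 0 ≤ mu) :
    ∃ M > 0, ∀ (n : ℕ), ∀ t ∈ Set.Icc (-1 : ℝ) 1,
      |(orthoGegenbauer lam mu n).eval t| ≤ M * ((n : ℝ) + 1) ^ max lam mu := by
  obtain ⟨A, hA, hA'⟩ := exists_sq_gegenbauerCoeffEven_le hlam hmu
  obtain ⟨B, hB, hB'⟩ := exists_sq_gegenbauerCoeffOdd_le hlam hmu
  obtain ⟨K, hK, hK'⟩ := exists_endpoint_bound hlam hmu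
  have hm : 0 ≤ max lam mu := le_max_of_le_right hmu
  -- Shared bookkeeping for both parities: the squared norming constant supplies one power of `k +
  -- 1`, which cancels the `-1` in the end point exponent. The factor 4 is needed for odd degrees.
  have key : ∀ (n k : ℕ) (c e D x : ℝ), k ≤ n → 0 < D → D ≤ A + B → c ^ 2 ≤ D * ((k : ℝ) + 1) →
      x ≤ K * ((k : ℝ) + 1) ^ (2 * max lam mu - 1) → e ^ 2 ≤ 4 * x →
      |c * e| ≤ Real.sqrt (4 * (A + B) * K) * ((n : ℝ) + 1) ^ max lam mu := by
    intro n k c e D x hkn hD hDAB hc hx he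
    have hk0 : (0 : ℝ) < k + 1 := by positivity
    refine abs_le_of_sq_le_sq ?_ (by positivity)
    rw [mul_pow, mul_pow, Real.sq_sqrt (by positivity), ← Real.rpow_mul_natCast (by positivity)]
    calc c ^ 2 * e ^ 2 ≤ (D * ((k : ℝ) + 1)) * (4 * (K * ((k : ℝ) + 1) ^ (2 * max lam mu - 1))) := by
          gcongr
          linarith
      _ = 4 * D * K * (((k : ℝ) + 1) ^ (2 * max lam mu - 1) * (k + 1)) := by ring
      _ = 4 * D * K * ((k : ℝ) + 1) ^ (max lam mu * (2 : ℕ)) := by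
          rw [← Real.rpow_add_one hk0.ne']
          congr 2
          push_cast
          ring
      _ ≤ _ := by
          gcongr
  refine ⟨Real.sqrt (4 * (A + B) * K), by positivity, fun n t ht => ?_⟩
  have hu := one_sub_sq_mem_Icc ht
  obtain ⟨k, rfl | rfl⟩ := Nat.even_or_odd' n
  · rw [eval_orthoGegenbauer_even]
    refine key _ k _ _ A _ (by omega) hA (by linarith) (hA' k) (hK' k) ?_
    refine (sq_shiftedJacobi_le (by linarith) (by linarith) k hu).trans ?_
    linarith [sq_nonneg ((shiftedJacobi (lam - 1 / 2) (mu - 1 / 2) k).eval 0),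
      sq_nonneg ((shiftedJacobi (lam - 1 / 2) (mu - 1 / 2) k).eval 1)]
  · rw [eval_orthoGegenbauer_odd]
    refine key _ k _ _ B _ (by omega) hB (by linarith) (hB' k) (hK' k) ?_
    have := one_sub_mul_sq_shiftedJacobi_add_one_right_le (α := lam - 1 / 2) (β := mu - 1 / 2)
      (by linarith) (by linarith) k hu
    rwa [sub_sub_cancel, ← mul_pow] at this

/-! ### Orthogonality from Beta moments alone. -/

theorem sum_comp_poly {ι : Type*} (s : Finset ι) (p : ι → ℝ[X]) (q : ℝ[X]) :
    (∑ i ∈ s, p i).comp q = ∑ i ∈ s, (p i).comp q :=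
  map_sum (compRingHom q) p s

theorem eq_sum_one_sub_X_pow (Q : ℝ[X]) {N : ℕ} (hN : Q.natDegree ≤ N) :
    Q = ∑ j ∈ Finset.range (N + 1), C ((Q.comp (1 - X)).coeff j) * (1 - X) ^ j := by
  have h1 : (1 - X : ℝ[X]).natDegree = 1 := by
    compute_degree!
  have h : (Q.comp (1 - X)).natDegree < N + 1 := by
    rw [natDegree_comp, h1, mul_one]
    omega
  calc Q = (Q.comp (1 - X)).comp (1 - X) := by simp [comp_assoc]
    _ = _ := by
      conv_lhs => rw [as_sum_range_C_mul_X_pow' _ h]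
      simp

theorem coeff_comp_one_sub_X (Q : ℝ[X]) {n : ℕ} (hn : Q.natDegree ≤ n) :
    (Q.comp (1 - X)).coeff n = (-1) ^ n * Q.coeff n := by
  have h1 : (1 - X : ℝ[X]).natDegree = 1 := by
    compute_degree!
  conv_lhs => rw [as_sum_range_C_mul_X_pow' Q (Nat.lt_succ_of_le hn)]
  simp only [sum_comp_poly, mul_comp, C_comp, pow_comp, X_comp, finsetSum_coeff, coeff_C_mul]
  rw [Finset.sum_range_succ, Finset.sum_eq_zero, zero_add]
  · have := coeff_pow_of_natDegree_le (m := n) h1.le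
    rw [mul_one] at this
    rw [this, mul_comm]
    simp [coeff_one]
  · intro k hk
    rw [coeff_eq_zero_of_natDegree_lt (p := (1 - X) ^ k), mul_zero]
    rw [natDegree_pow, h1]
    simpa using hk

section BetaFunctional

variable {α β : ℝ} {L : ℝ[X] →ₗ[ℝ] ℝ}

/-- Pairing with powers of `1 - X`, rather than of `X`, makes the alternating sum of Beta moments a
Chu–Vandermonde sum. The resulting factor `(j + 1 - n)_n` vanishes for `j < n` and equals `n!` for
`j = n`. -/
theorem map_shiftedJacobi_mul_one_sub_X_pow (hα : -1 < α) (hβ : -1 < β)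
    (hL : ∀ k j : ℕ, L (X ^ k * (1 - X) ^ j) =
      Real.Gamma (α + 1 + k) * Real.Gamma (β + 1 + j) / Real.Gamma (α + β + 2 + j + k))
    (n j : ℕ) :
    L (shiftedJacobi α β n * (1 - X) ^ j) =
      Real.Gamma (α + 1 + n) * Real.Gamma (β + 1 + j) /
        (n.factorial * Real.Gamma (α + β + 2 + j + n)) *
        (ascPochhammer ℝ n).eval ((j : ℝ) + 1 - n) := by
  have hj : (0 : ℝ) ≤ j := Nat.cast_nonneg j
  rw [show (j : ℝ) + 1 - n = α + β + 2 + j - (n + α + β + 1) by ring,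
    ← sum_neg_one_pow_choose_mul_ascPochhammer, shiftedJacobi, Finset.sum_mul, map_sum,
    Finset.mul_sum]
  refine Finset.sum_congr rfl fun k hk => ?_
  have hk : k ≤ n := by simpa [Nat.lt_succ_iff] using hk
  have hk0 : (0 : ℝ) ≤ k := Nat.cast_nonneg k
  rw [mul_assoc, C_mul', map_smul, hL, smul_eq_mul, jacobiCoeff]
  have h1 := ascPochhammer_eval_mul_Gamma (n - k) (a := α + 1 + k) (by linarith)
  have h2 := ascPochhammer_eval_mul_Gamma (n - k) (a := α + β + 2 + j + k) (by linarith)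
  rw [Nat.cast_sub hk, show α + 1 + (k : ℝ) + (n - k) = α + 1 + n by ring] at h1
  rw [Nat.cast_sub hk, show α + β + 2 + j + (k : ℝ) + (n - k) = α + β + 2 + j + n by ring] at h2
  have h3 : 0 < Real.Gamma (α + β + 2 + j + k) := Real.Gamma_pos_of_pos (by linarith)
  have h4 : 0 < (ascPochhammer ℝ (n - k)).eval (α + β + 2 + j + k) :=
    ascPochhammer_pos _ _ (by linarith)
  rw [← h1, ← h2]
  have : (0 : ℝ) < n.factorial := by positivity
  field_simp

/-- In the expansion of `Q` in powers of `1 - X`, only the power `n` survives the pairing. -/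
theorem map_shiftedJacobi_mul_eq (hα : -1 < α) (hβ : -1 < β)
    (hL : ∀ k j : ℕ, L (X ^ k * (1 - X) ^ j) =
      Real.Gamma (α + 1 + k) * Real.Gamma (β + 1 + j) / Real.Gamma (α + β + 2 + j + k))
    (n : ℕ) {Q : ℝ[X]} (hQ : Q.natDegree ≤ n) :
    L (shiftedJacobi α β n * Q) = (-1) ^ n * Q.coeff n * (Real.Gamma (α + 1 + n) *
      Real.Gamma (β + 1 + n) / Real.Gamma (α + β + 2 + n + n)) := by
  conv_lhs => rw [eq_sum_one_sub_X_pow Q hQ]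
  rw [Finset.mul_sum, map_sum, Finset.sum_range_succ, Finset.sum_eq_zero, zero_add]
  · rw [mul_left_comm, C_mul', map_smul, map_shiftedJacobi_mul_one_sub_X_pow hα hβ hL,
      coeff_comp_one_sub_X Q hQ, smul_eq_mul, add_sub_cancel_left, ascPochhammer_eval_one]
    have : (n.factorial : ℝ) ≠ 0 := by positivity
    field_simp
  · intro j hj
    rw [mul_left_comm, C_mul', map_smul, map_shiftedJacobi_mul_one_sub_X_pow hα hβ hL,
      (ascPochhammer_eval_eq_zero_iff n _).2, mul_zero, smul_zero]
    have hj : j < n := by simpa using hj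
    refine ⟨n - (j + 1), by omega, ?_⟩
    rw [Nat.cast_sub hj]
    push_cast
    ring

theorem map_shiftedJacobi_mul_of_ne (hα : -1 < α) (hβ : -1 < β)
    (hL : ∀ k j : ℕ, L (X ^ k * (1 - X) ^ j) =
      Real.Gamma (α + 1 + k) * Real.Gamma (β + 1 + j) / Real.Gamma (α + β + 2 + j + k))
    {m n : ℕ} (h : m ≠ n) : L (shiftedJacobi α β m * shiftedJacobi α β n) = 0 := by
  wlog hmn : m < n generalizing m n
  · rw [mul_comm]
    exact this h.symm (by omega)
  rw [mul_comm, map_shiftedJacobi_mul_eq hα hβ hL n ((natDegree_shiftedJacobi_le α β m).trans hmn.le),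
    coeff_eq_zero_of_natDegree_lt ((natDegree_shiftedJacobi_le α β m).trans_lt hmn)]
  simp

theorem map_shiftedJacobi_mul_self (hα : -1 < α) (hβ : -1 < β)
    (hL : ∀ k j : ℕ, L (X ^ k * (1 - X) ^ j) =
      Real.Gamma (α + 1 + k) * Real.Gamma (β + 1 + j) / Real.Gamma (α + β + 2 + j + k))
    {n : ℕ} (hn : 0 < (n : ℝ) + α + β + 1) :
    L (shiftedJacobi α β n * shiftedJacobi α β n) =
      Real.Gamma (α + 1 + n) * Real.Gamma (β + 1 + n) /
        ((2 * n + α + β + 1) * n.factorial * Real.Gamma (n + α + β + 1)) := by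
  rw [map_shiftedJacobi_mul_eq hα hβ hL n (natDegree_shiftedJacobi_le α β n), coeff_shiftedJacobi,
    jacobiCoeff]
  have h := ascPochhammer_eval_mul_Gamma n hn
  have hn0 : (0 : ℝ) ≤ n := Nat.cast_nonneg n
  have h2 : 0 < 2 * (n : ℝ) + α + β + 1 := by linarith
  rw [show α + β + 2 + (n : ℝ) + n = n + α + β + 1 + n + 1 by ring,
    Real.Gamma_add_one (by linarith), ← h]
  have h3 := Real.Gamma_pos_of_pos hn
  have h4 := ascPochhammer_pos n _ hn
  have h5 : (n.factorial : ℝ) ≠ 0 := by positivity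
  have h6 : (n : ℝ) + α + β + 1 + n = 2 * n + α + β + 1 := by ring
  have h7 : ((-1 : ℝ) ^ n) * (-1) ^ n = 1 := by rw [← mul_pow]; simp
  rw [h6]
  generalize (-1 : ℝ) ^ n = s at h7 ⊢
  simp only [Nat.choose_self, Nat.sub_self, ascPochhammer_zero, eval_one, Nat.cast_one, one_mul,
    mul_one]
  have h8 : s ^ 2 = 1 := by rw [sq, h7]
  field_simp
  rw [h8, one_mul]

end BetaFunctional

/-! ### The weight and its moments. -/

theorem integrableOn_rpow_mul_one_sub_rpow {a b : ℝ} (ha : 0 < a) (hb : 0 < b) :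
    IntegrableOn (fun x : ℝ => x ^ (a - 1) * (1 - x) ^ (b - 1)) (Set.Ioo 0 1) := by
  have h := Complex.betaIntegral_convergent (u := a) (v := b) (by simpa) (by simpa)
  rw [intervalIntegrable_iff_integrableOn_Ioo_of_le zero_le_one] at h
  refine (integrableOn_congr_fun (fun x hx => ?_) measurableSet_Ioo).1 h.re
  have h1 := hx.1.le
  have h2 : 0 ≤ 1 - x := by linarith [hx.2]
  rw [RCLike.re_to_complex]
  norm_cast
  rw [← Complex.ofReal_cpow h1, ← Complex.ofReal_cpow h2, ← Complex.ofReal_mul, Complex.ofReal_re]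

theorem integral_rpow_mul_one_sub_rpow {a b : ℝ} (ha : 0 < a) (hb : 0 < b) :
    ∫ x in Set.Ioo (0 : ℝ) 1, x ^ (a - 1) * (1 - x) ^ (b - 1) =
      Real.Gamma a * Real.Gamma b / Real.Gamma (a + b) := by
  have h := Complex.betaIntegral_convergent (u := a) (v := b) (by simpa) (by simpa)
  rw [intervalIntegrable_iff_integrableOn_Ioo_of_le zero_le_one] at h
  rw [← ProbabilityTheory.beta, ProbabilityTheory.beta_eq_betaIntegralReal a b ha hb,
    Complex.betaIntegral, intervalIntegral.integral_of_le zero_le_one, integral_Ioc_eq_integral_Ioo,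
    ← RCLike.re_to_complex, ← integral_re h]
  refine setIntegral_congr_fun measurableSet_Ioo fun x hx => ?_
  have h1 := hx.1.le
  have h2 : 0 ≤ 1 - x := by linarith [hx.2]
  rw [RCLike.re_to_complex]
  norm_cast
  rw [← Complex.ofReal_cpow h1, ← Complex.ofReal_cpow h2, ← Complex.ofReal_mul, Complex.ofReal_re]

theorem gegenbauerWeight_neg (lam mu t : ℝ) :
    gegenbauerWeight lam mu (-t) = gegenbauerWeight lam mu t := by
  simp [gegenbauerWeight]

theorem gegenbauerWeight_nonneg (lam mu : ℝ) {t : ℝ} (ht : t ∈ Set.Icc (-1 : ℝ) 1) :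
    0 ≤ gegenbauerWeight lam mu t := by
  have := (one_sub_sq_mem_Icc ht).1
  unfold gegenbauerWeight
  positivity

theorem measurable_gegenbauerWeight (lam mu : ℝ) : Measurable (gegenbauerWeight lam mu) := by
  unfold gegenbauerWeight
  fun_prop

theorem image_sq_Ioo : (fun t : ℝ => t ^ 2) '' Set.Ioo 0 1 = Set.Ioo 0 1 := by
  ext x
  constructor
  · rintro ⟨t, ht, rfl⟩
    exact ⟨pow_pos ht.1 2, pow_lt_one₀ ht.1.le ht.2 two_ne_zero⟩
  · intro hx
    refine ⟨Real.sqrt x, ⟨Real.sqrt_pos.2 hx.1, ?_⟩, Real.sq_sqrt hx.1.le⟩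
    rw [Real.sqrt_lt' one_pos]
    linarith [hx.2]

/-- Under `x = t²` the Beta density becomes twice the weight. -/
theorem abs_deriv_sq_smul_eq (lam mu : ℝ) {t : ℝ} (ht : t ∈ Set.Ioo (0 : ℝ) 1) :
    |2 * t| • ((t ^ 2) ^ (mu + 1 / 2 - 1) * (1 - t ^ 2) ^ (lam + 1 / 2 - 1)) =
      2 * gegenbauerWeight lam mu t := by
  have h : (t ^ 2) ^ (mu + 1 / 2 - 1) * t = t ^ (2 * mu) := by
    rw [← Real.rpow_natCast, ← Real.rpow_mul ht.1.le, ← Real.rpow_add_one ht.1.ne']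
    congr 1
    push_cast
    ring
  rw [gegenbauerWeight, abs_of_pos ht.1, abs_of_pos (by linarith [ht.1]), ← h, smul_eq_mul,
    show lam + 1 / 2 - 1 = lam - 1 / 2 by ring]
  ring

section

variable {lam mu : ℝ}

theorem integrableOn_gegenbauerWeight_Ioo (hlam : -(1 / 2) < lam) (hmu : 0 ≤ mu) :
    IntegrableOn (gegenbauerWeight lam mu) (Set.Ioo 0 1) := by
  have h := integrableOn_rpow_mul_one_sub_rpow (a := mu + 1 / 2) (b := lam + 1 / 2) (by linarith)
    (by linarith)
  rw [← image_sq_Ioo, integrableOn_image_iff_integrableOn_abs_deriv_smul measurableSet_Ioo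
    (f' := fun t => 2 * t) (fun x _ => by simpa using (hasDerivAt_pow 2 x).hasDerivWithinAt)
    (fun x hx y hy h => (pow_left_inj₀ hx.1.le hy.1.le two_ne_zero).1 h),
    integrableOn_congr_fun (fun t ht => abs_deriv_sq_smul_eq lam mu ht) measurableSet_Ioo] at h
  simpa [IntegrableOn] using h.const_mul (1 / 2)

theorem two_mul_integral_gegenbauerWeight_Ioo (hlam : -(1 / 2) < lam) (hmu : 0 ≤ mu) :
    2 * ∫ t in Set.Ioo 0 1, gegenbauerWeight lam mu t =
      Real.Gamma (mu + 1 / 2) * Real.Gamma (lam + 1 / 2) / Real.Gamma (lam + mu + 1) := by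
  have h := integral_rpow_mul_one_sub_rpow (a := mu + 1 / 2) (b := lam + 1 / 2) (by linarith)
    (by linarith)
  rw [← image_sq_Ioo, integral_image_eq_integral_abs_deriv_smul measurableSet_Ioo
    (f' := fun t => 2 * t) (fun x _ => by simpa using (hasDerivAt_pow 2 x).hasDerivWithinAt)
    (fun x hx y hy h => (pow_left_inj₀ hx.1.le hy.1.le two_ne_zero).1 h),
    setIntegral_congr_fun measurableSet_Ioo (fun t ht => abs_deriv_sq_smul_eq lam mu ht),
    integral_const_mul] at h
  rw [h, show mu + 1 / 2 + (lam + 1 / 2) = lam + mu + 1 by ring]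

theorem intervalIntegrable_gegenbauerWeight_zero_one (hlam : -(1 / 2) < lam) (hmu : 0 ≤ mu) :
    IntervalIntegrable (gegenbauerWeight lam mu) volume 0 1 := by
  rw [intervalIntegrable_iff_integrableOn_Ioo_of_le zero_le_one]
  exact integrableOn_gegenbauerWeight_Ioo hlam hmu

theorem intervalIntegrable_gegenbauerWeight_neg_one_zero (hlam : -(1 / 2) < lam) (hmu : 0 ≤ mu) :
    IntervalIntegrable (gegenbauerWeight lam mu) volume (-1) 0 := by
  rw [IntervalIntegrable.iff_comp_neg]
  simp only [gegenbauerWeight_neg, neg_neg, neg_zero]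
  exact (intervalIntegrable_gegenbauerWeight_zero_one hlam hmu).symm

theorem integrableOn_gegenbauerWeight (hlam : -(1 / 2) < lam) (hmu : 0 ≤ mu) :
    IntegrableOn (gegenbauerWeight lam mu) (Set.Icc (-1) 1) := by
  rw [integrableOn_Icc_iff_integrableOn_Ioc,
    ← intervalIntegrable_iff_integrableOn_Ioc_of_le (by norm_num)]
  exact (intervalIntegrable_gegenbauerWeight_neg_one_zero hlam hmu).trans
    (intervalIntegrable_gegenbauerWeight_zero_one hlam hmu)

theorem integral_gegenbauerWeight (hlam : -(1 / 2) < lam) (hmu : 0 ≤ mu) :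
    ∫ t in Set.Icc (-1) 1, gegenbauerWeight lam mu t =
      Real.Gamma (mu + 1 / 2) * Real.Gamma (lam + 1 / 2) / Real.Gamma (lam + mu + 1) := by
  have h : ∫ t in (-1)..0, gegenbauerWeight lam mu t = ∫ t in 0..1, gegenbauerWeight lam mu t := by
    have := intervalIntegral.integral_comp_neg (gegenbauerWeight lam mu) (a := 0) (b := 1)
    simp only [gegenbauerWeight_neg, neg_zero] at this
    exact this.symm
  rw [← two_mul_integral_gegenbauerWeight_Ioo hlam hmu, integral_Icc_eq_integral_Ioc,
    ← intervalIntegral.integral_of_le (by norm_num),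
    ← intervalIntegral.integral_add_adjacent_intervals
      (intervalIntegrable_gegenbauerWeight_neg_one_zero hlam hmu)
      (intervalIntegrable_gegenbauerWeight_zero_one hlam hmu), h,
    ← integral_Ioc_eq_integral_Ioo, ← intervalIntegral.integral_of_le zero_le_one, two_mul]

theorem integral_gegenbauerMeasure (lam mu : ℝ) (f : ℝ → ℝ) :
    ∫ t, f t ∂gegenbauerMeasure lam mu =
      ∫ t in Set.Icc (-1) 1, gegenbauerWeight lam mu t * f t := by
  rw [gegenbauerMeasure, integral_withDensity_eq_integral_toReal_smul
    (measurable_gegenbauerWeight lam mu).ennreal_ofReal (by simp)]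
  refine setIntegral_congr_fun measurableSet_Icc fun t ht => ?_
  simp [ENNReal.toReal_ofReal (gegenbauerWeight_nonneg lam mu ht)]

theorem isFiniteMeasure_gegenbauerMeasure (hlam : -(1 / 2) < lam) (hmu : 0 ≤ mu) :
    IsFiniteMeasure (gegenbauerMeasure lam mu) :=
  isFiniteMeasure_withDensity_ofReal (integrableOn_gegenbauerWeight hlam hmu).hasFiniteIntegral

theorem ae_mem_Icc_gegenbauerMeasure (lam mu : ℝ) :
    ∀ᵐ t ∂gegenbauerMeasure lam mu, t ∈ Set.Icc (-1 : ℝ) 1 :=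
  (withDensity_absolutelyContinuous _ _).ae_le (ae_restrict_mem measurableSet_Icc)

theorem integrable_gegenbauerMeasure_of_continuous (hlam : -(1 / 2) < lam) (hmu : 0 ≤ mu)
    {f : ℝ → ℝ} (hf : Continuous f) : Integrable f (gegenbauerMeasure lam mu) := by
  have := isFiniteMeasure_gegenbauerMeasure hlam hmu
  obtain ⟨C, hC⟩ := isCompact_Icc.exists_bound_of_continuousOn (hf.continuousOn (s := Set.Icc (-1) 1))
  refine Integrable.of_bound hf.aestronglyMeasurable C ?_
  filter_upwards [ae_mem_Icc_gegenbauerMeasure lam mu] with t ht using hC t ht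

theorem integral_gegenbauerMeasure_of_odd (lam mu : ℝ) {f : ℝ → ℝ} (hf : ∀ t, f (-t) = -f t) :
    ∫ t, f t ∂gegenbauerMeasure lam mu = 0 := by
  rw [integral_gegenbauerMeasure, integral_Icc_eq_integral_Ioc,
    ← intervalIntegral.integral_of_le (by norm_num)]
  have h := intervalIntegral.integral_comp_neg (fun t => gegenbauerWeight lam mu t * f t)
    (a := -1) (b := 1)
  simp only [gegenbauerWeight_neg, hf, mul_neg, intervalIntegral.integral_neg, neg_neg] at h
  linarith

/-- Such a factor only shifts the parameters of the weight, so every moment needed is the total mass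
of another weight of the family. -/
theorem gegenbauerWeight_mul_pow (hlam : -(1 / 2) < lam) (hmu : 0 ≤ mu) (k j : ℕ) {t : ℝ}
    (ht : t ∈ Set.Icc (-1 : ℝ) 1) :
    gegenbauerWeight lam mu t * ((1 - t ^ 2) ^ k * (t ^ 2) ^ j) =
      gegenbauerWeight (lam + k) (mu + j) t := by
  have h1 : (1 - t ^ 2) ^ (lam + k - 1 / 2) = (1 - t ^ 2) ^ (lam - 1 / 2) * (1 - t ^ 2) ^ k := by
    -- The base may be 0, so splitting the power requires a nonzero total exponent; it is positive
    -- once `k ≥ 1`.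
    rcases k with _ | k
    · simp
    · have hk := Nat.cast_nonneg (α := ℝ) k
      rw [← Real.rpow_add_natCast' (one_sub_sq_mem_Icc ht).1]
      · congr 1
        ring
      · push_cast
        linarith
  have h2 : |t| ^ (2 * (mu + j)) = |t| ^ (2 * mu) * (t ^ 2) ^ j := by
    rcases j with _ | j
    · simp
    · rw [← sq_abs, ← pow_mul, ← Real.rpow_add_natCast' (abs_nonneg t)]
      · congr 1
        push_cast
        ring
      · positivity
  rw [gegenbauerWeight, gegenbauerWeight, h1, h2]
  ring

theorem integral_one_sub_sq_pow_mul_sq_pow (hlam : -(1 / 2) < lam) (hmu : 0 ≤ mu) (k j : ℕ) :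
    ∫ t, (1 - t ^ 2) ^ k * (t ^ 2) ^ j ∂gegenbauerMeasure lam mu =
      Real.Gamma (lam + 1 / 2 + k) * Real.Gamma (mu + 1 / 2 + j) /
        Real.Gamma (lam + mu + 1 + j + k) := by
  rw [integral_gegenbauerMeasure, setIntegral_congr_fun measurableSet_Icc
    (fun t ht => gegenbauerWeight_mul_pow hlam hmu k j ht), integral_gegenbauerWeight
    (by linarith [Nat.cast_nonneg (α := ℝ) k]) (by positivity)]
  ring_nf

end

/-! ### Orthonormality of the generalized Gegenbauer polynomials. -/

noncomputable section

/-- The linear functional `Q ↦ ∫ t^{2i} Q(1 - t²) v_{λ,μ}(t) dt` on polynomials. -/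
def gegenbauerFunctional {lam mu : ℝ} (hlam : -(1 / 2) < lam) (hmu : 0 ≤ mu) (i : ℕ) :
    ℝ[X] →ₗ[ℝ] ℝ where
  toFun Q := ∫ t, (t ^ 2) ^ i * Q.eval (1 - t ^ 2) ∂gegenbauerMeasure lam mu
  map_add' P Q := by
    simp only [eval_add, mul_add]
    exact integral_add (integrable_gegenbauerMeasure_of_continuous hlam hmu (by fun_prop))
      (integrable_gegenbauerMeasure_of_continuous hlam hmu (by fun_prop))
  map_smul' c Q := by
    simp only [eval_smul, smul_eq_mul, RingHom.id_apply, mul_left_comm _ c]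
    exact integral_const_mul _ _

end

section

variable {lam mu : ℝ}

theorem gegenbauerFunctional_apply (hlam : -(1 / 2) < lam) (hmu : 0 ≤ mu) (i : ℕ) (Q : ℝ[X]) :
    gegenbauerFunctional hlam hmu i Q =
      ∫ t, (t ^ 2) ^ i * Q.eval (1 - t ^ 2) ∂gegenbauerMeasure lam mu := rfl

theorem gegenbauerFunctional_moment (hlam : -(1 / 2) < lam) (hmu : 0 ≤ mu) (i k j : ℕ) :
    gegenbauerFunctional hlam hmu i (X ^ k * (1 - X) ^ j) =
      Real.Gamma (lam - 1 / 2 + 1 + k) * Real.Gamma (mu - 1 / 2 + i + 1 + j) /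
        Real.Gamma (lam - 1 / 2 + (mu - 1 / 2 + i) + 2 + j + k) := by
  have h := integral_one_sub_sq_pow_mul_sq_pow hlam hmu k (i + j)
  push_cast at h
  rw [show lam - 1 / 2 + 1 + k = lam + 1 / 2 + k by ring,
    show mu - 1 / 2 + i + 1 + j = mu + 1 / 2 + (i + j) by ring,
    show lam - 1 / 2 + (mu - 1 / 2 + i) + 2 + j + k = lam + mu + 1 + (i + j) + k by ring, ← h,
    gegenbauerFunctional_apply]
  refine integral_congr_ae (Eventually.of_forall fun t => ?_)
  simp only [eval_mul, eval_pow, eval_X, eval_sub, eval_one, sub_sub_cancel]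
  ring

theorem integral_even_mul_even (hlam : -(1 / 2) < lam) (hmu : 0 ≤ mu) (k l : ℕ) :
    ∫ t, (orthoGegenbauer lam mu (2 * k)).eval t * (orthoGegenbauer lam mu (2 * l)).eval t
      ∂gegenbauerMeasure lam mu = gegenbauerCoeffEven lam mu k * gegenbauerCoeffEven lam mu l *
        gegenbauerFunctional hlam hmu 0 (shiftedJacobi (lam - 1 / 2) (mu - 1 / 2) k *
          shiftedJacobi (lam - 1 / 2) (mu - 1 / 2) l) := by
  rw [gegenbauerFunctional_apply, ← integral_const_mul]
  refine integral_congr_ae (Eventually.of_forall fun t => ?_)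
  simp only [eval_orthoGegenbauer_even, eval_mul]
  ring

theorem integral_odd_mul_odd (hlam : -(1 / 2) < lam) (hmu : 0 ≤ mu) (k l : ℕ) :
    ∫ t, (orthoGegenbauer lam mu (2 * k + 1)).eval t * (orthoGegenbauer lam mu (2 * l + 1)).eval t
      ∂gegenbauerMeasure lam mu = gegenbauerCoeffOdd lam mu k * gegenbauerCoeffOdd lam mu l *
        gegenbauerFunctional hlam hmu 1 (shiftedJacobi (lam - 1 / 2) (mu - 1 / 2 + 1) k *
          shiftedJacobi (lam - 1 / 2) (mu - 1 / 2 + 1) l) := by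
  rw [gegenbauerFunctional_apply, ← integral_const_mul]
  refine integral_congr_ae (Eventually.of_forall fun t => ?_)
  simp only [eval_orthoGegenbauer_odd, eval_mul]
  ring

theorem integral_even_mul_odd (k l : ℕ) :
    ∫ t, (orthoGegenbauer lam mu (2 * k)).eval t * (orthoGegenbauer lam mu (2 * l + 1)).eval t
      ∂gegenbauerMeasure lam mu = 0 := by
  refine integral_gegenbauerMeasure_of_odd lam mu fun t => ?_
  simp only [eval_orthoGegenbauer_odd, eval_orthoGegenbauer_even, neg_sq]
  ring

theorem integral_even_mul_self (hlam : -(1 / 2) < lam) (hmu : 0 ≤ mu) (k : ℕ) :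
    ∫ t, (orthoGegenbauer lam mu (2 * k)).eval t * (orthoGegenbauer lam mu (2 * k)).eval t
      ∂gegenbauerMeasure lam mu = 1 := by
  have hk := Nat.cast_nonneg (α := ℝ) k
  have hL := gegenbauerFunctional_moment hlam hmu 0
  simp only [Nat.cast_zero, add_zero] at hL
  have h1 : 0 < Real.Gamma (k + lam + 1 / 2) := Real.Gamma_pos_of_pos (by linarith)
  have h2 : 0 < Real.Gamma (k + mu + 1 / 2) := Real.Gamma_pos_of_pos (by linarith)
  rw [integral_even_mul_even hlam hmu]
  rcases k with _ | k
  -- In degree 0 the quantity `n + α + β + 1 = lam + mu` need not be positive, so the general norm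
  -- formula does not apply.
  · have h := map_shiftedJacobi_mul_eq (by linarith) (by linarith) hL 0
      (natDegree_shiftedJacobi_le (lam - 1 / 2) (mu - 1 / 2) 0)
    have h3 : 0 < Real.Gamma (lam + mu + 1) := Real.Gamma_pos_of_pos (by linarith)
    rw [h, coeff_shiftedJacobi, gegenbauerCoeffEven, if_pos rfl,
      Real.mul_self_sqrt (by positivity)]
    simp only [Nat.cast_zero, zero_add, add_zero] at h1 h2 ⊢
    rw [show lam - 1 / 2 + 1 = lam + 1 / 2 by ring, show mu - 1 / 2 + 1 = mu + 1 / 2 by ring,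
      show lam - 1 / 2 + (mu - 1 / 2) + 2 = lam + mu + 1 by ring]
    simp only [jacobiCoeff]
    generalize Real.Gamma (lam + 1 / 2) = a at h1 ⊢
    simp only [Nat.choose_self, Nat.sub_self, ascPochhammer_zero, eval_one, Nat.cast_one, one_mul,
      mul_one, pow_zero, Nat.factorial_zero, div_one]
    field_simp
  · push_cast at hk h1 h2
    rw [map_shiftedJacobi_mul_self (by linarith) (by linarith) hL (by push_cast; linarith),
      gegenbauerCoeffEven, if_neg k.succ_ne_zero, Real.Gamma_nat_eq_factorial]
    have h3 : 0 < Real.Gamma ((k + 1 : ℕ) + lam + mu) :=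
      Real.Gamma_pos_of_pos (by push_cast; linarith)
    have h4 : 0 < 2 * ((k + 1 : ℕ) : ℝ) + lam + mu := by push_cast; linarith
    have h5 : (0 : ℝ) < (k + 1).factorial := by positivity
    push_cast at h3 h4 ⊢
    rw [Real.mul_self_sqrt (by positivity),
      show lam - 1 / 2 + 1 + ((k : ℝ) + 1) = k + 1 + lam + 1 / 2 by ring,
      show mu - 1 / 2 + 1 + ((k : ℝ) + 1) = k + 1 + mu + 1 / 2 by ring,
      show 2 * ((k : ℝ) + 1) + (lam - 1 / 2) + (mu - 1 / 2) + 1 = 2 * (k + 1) + lam + mu by ring,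
      show (k : ℝ) + 1 + (lam - 1 / 2) + (mu - 1 / 2) + 1 = k + 1 + lam + mu by ring]
    generalize Real.Gamma (k + 1 + lam + 1 / 2) = a at h1 ⊢
    field_simp

theorem integral_odd_mul_self (hlam : -(1 / 2) < lam) (hmu : 0 ≤ mu) (k : ℕ) :
    ∫ t, (orthoGegenbauer lam mu (2 * k + 1)).eval t * (orthoGegenbauer lam mu (2 * k + 1)).eval t
      ∂gegenbauerMeasure lam mu = 1 := by
  have hk := Nat.cast_nonneg (α := ℝ) k
  have hL := gegenbauerFunctional_moment hlam hmu 1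
  simp only [Nat.cast_one] at hL
  have h1 : 0 < Real.Gamma (k + lam + 1 / 2) := Real.Gamma_pos_of_pos (by linarith)
  have h2 : 0 < Real.Gamma (k + mu + 3 / 2) := Real.Gamma_pos_of_pos (by linarith)
  have h3 : 0 < Real.Gamma (k + lam + mu + 1) := Real.Gamma_pos_of_pos (by linarith)
  have h4 : 0 < 2 * (k : ℝ) + lam + mu + 1 := by linarith
  have h5 : (0 : ℝ) < k.factorial := by positivity
  rw [integral_odd_mul_odd hlam hmu, map_shiftedJacobi_mul_self (by linarith) (by linarith) hL
    (by linarith), gegenbauerCoeffOdd, Real.Gamma_nat_eq_factorial,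
    Real.mul_self_sqrt (by positivity), show lam - 1 / 2 + 1 + (k : ℝ) = k + lam + 1 / 2 by ring,
    show mu - 1 / 2 + 1 + 1 + (k : ℝ) = k + mu + 3 / 2 by ring,
    show 2 * (k : ℝ) + (lam - 1 / 2) + (mu - 1 / 2 + 1) + 1 = 2 * k + lam + mu + 1 by ring,
    show (k : ℝ) + (lam - 1 / 2) + (mu - 1 / 2 + 1) + 1 = k + lam + mu + 1 by ring]
  generalize Real.Gamma (k + lam + 1 / 2) = a at h1 ⊢
  field_simp

theorem integral_orthoGegenbauer_mul (hlam : -(1 / 2) < lam) (hmu : 0 ≤ mu) (m n : ℕ) :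
    ∫ t, (orthoGegenbauer lam mu m).eval t * (orthoGegenbauer lam mu n).eval t
      ∂gegenbauerMeasure lam mu = if m = n then 1 else 0 := by
  obtain ⟨k, rfl | rfl⟩ := Nat.even_or_odd' m <;> obtain ⟨l, rfl | rfl⟩ := Nat.even_or_odd' n
  · split_ifs with h
    · rw [h, integral_even_mul_self hlam hmu]
    · have hL := gegenbauerFunctional_moment hlam hmu 0
      simp only [Nat.cast_zero, add_zero] at hL
      rw [integral_even_mul_even hlam hmu, map_shiftedJacobi_mul_of_ne (by linarith) (by linarith) hL
        (by omega), mul_zero]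
  · rw [integral_even_mul_odd, if_neg (by omega)]
  · simp only [mul_comm (eval _ (orthoGegenbauer lam mu (2 * k + 1)))]
    rw [integral_even_mul_odd, if_neg (by omega)]
  · split_ifs with h
    · rw [h, integral_odd_mul_self hlam hmu]
    · have hL := gegenbauerFunctional_moment hlam hmu 1
      simp only [Nat.cast_one] at hL
      rw [integral_odd_mul_odd hlam hmu, map_shiftedJacobi_mul_of_ne (by linarith) (by linarith) hL
        (by omega), mul_zero]

end

/-! ### Layer integrals and tail sums for the interpolation. -/

theorem setLIntegral_Ioi_ite_lt_rpow {r g : ℝ} (hr : -1 < r) (hg : 0 ≤ g) :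
    ∫⁻ y in Set.Ioi (0 : ℝ), (if y < g then ENNReal.ofReal (y ^ r) else 0) =
      ENNReal.ofReal (g ^ (r + 1) / (r + 1)) := by
  have h1 : ∀ y : ℝ, (if y < g then ENNReal.ofReal (y ^ r) else 0) =
      (Set.Iio g).indicator (fun y => ENNReal.ofReal (y ^ r)) y := fun y => by
    simp [Set.indicator_apply]
  have h2 : IntegrableOn (fun y : ℝ => y ^ r) (Set.Ioo 0 g) := by
    rw [← intervalIntegrable_iff_integrableOn_Ioo_of_le hg]
    exact intervalIntegral.intervalIntegrable_rpow' hr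
  simp_rw [h1]
  rw [lintegral_indicator measurableSet_Iio, Measure.restrict_restrict measurableSet_Iio,
    Set.inter_comm, Set.Ioi_inter_Iio, ← ofReal_integral_eq_lintegral_ofReal h2,
    ← integral_Ioc_eq_integral_Ioo, ← intervalIntegral.integral_of_le hg,
    integral_rpow (Or.inl hr), Real.zero_rpow (by linarith), sub_zero]
  filter_upwards [ae_restrict_mem measurableSet_Ioo] with y hy using Real.rpow_nonneg hy.1.le _

theorem setLIntegral_Ioi_ite_le_rpow {r g : ℝ} (hr : r < -1) (hg : 0 < g) :
    ∫⁻ y in Set.Ioi (0 : ℝ), (if g ≤ y then ENNReal.ofReal (y ^ r) else 0) =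
      ENNReal.ofReal (g ^ (r + 1) / (-(r + 1))) := by
  have h1 : ∀ y : ℝ, (if g ≤ y then ENNReal.ofReal (y ^ r) else 0) =
      (Set.Ici g).indicator (fun y => ENNReal.ofReal (y ^ r)) y := fun y => by
    simp [Set.indicator_apply]
  simp_rw [h1]
  rw [lintegral_indicator measurableSet_Ici, Measure.restrict_restrict measurableSet_Ici,
    Set.inter_eq_left.2 (Set.Ici_subset_Ioi.2 hg), setLIntegral_congr Ioi_ae_eq_Ici.symm,
    ← ofReal_integral_eq_lintegral_ofReal (integrableOn_Ioi_rpow_of_lt hr hg),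
    integral_Ioi_rpow_of_lt hr hg, div_neg, neg_div]
  filter_upwards [ae_restrict_mem measurableSet_Ioi] with y hy
  exact Real.rpow_nonneg (hg.trans hy).le _

section Layers

variable {Ω : Type*} [MeasurableSpace Ω] {m : Measure Ω} [SFinite m] {h : Ω → ℝ} {p : ℝ}

theorem measurable_lintegral_upper (hm : Measurable h) :
    Measurable fun y : ℝ => ∫⁻ x, (if y < h x then ENNReal.ofReal (h x) else 0) ∂m := by
  refine Measurable.lintegral_prod_right (f := fun y x => if y < h x then ENNReal.ofReal (h x) else 0)
    (Measurable.ite (measurableSet_lt (by fun_prop) (by fun_prop)) ?_ measurable_const)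
  exact (hm.comp measurable_snd).ennreal_ofReal

/-- By Tonelli the inner integral is that of `y^(p-2)` over `(0, h x)`, finite because `p > 1`. -/
theorem lintegral_rpow_mul_lintegral_upper (hm : Measurable h) (h0 : ∀ x, 0 ≤ h x) (hp : 1 < p) :
    ∫⁻ y in Set.Ioi (0 : ℝ), ENNReal.ofReal (y ^ (p - 2)) *
        ∫⁻ x, (if y < h x then ENNReal.ofReal (h x) else 0) ∂m =
      ENNReal.ofReal (1 / (p - 1)) * ∫⁻ x, ENNReal.ofReal (h x ^ p) ∂m := by
  have e : ∀ y : ℝ, ENNReal.ofReal (y ^ (p - 2)) *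
      ∫⁻ x, (if y < h x then ENNReal.ofReal (h x) else 0) ∂m =
      ∫⁻ x, ENNReal.ofReal (h x) * (if y < h x then ENNReal.ofReal (y ^ (p - 2)) else 0) ∂m := by
    intro y
    rw [← lintegral_const_mul' _ _ ENNReal.ofReal_ne_top]
    refine lintegral_congr fun x => ?_
    split_ifs <;> simp [mul_comm]
  simp_rw [e]
  rw [lintegral_lintegral_swap, ← lintegral_const_mul' _ _ ENNReal.ofReal_ne_top]
  · refine lintegral_congr fun x => ?_
    rw [lintegral_const_mul' _ _ ENNReal.ofReal_ne_top,
      setLIntegral_Ioi_ite_lt_rpow (by linarith) (h0 x), ← ENNReal.ofReal_mul (h0 x),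
      ← ENNReal.ofReal_mul (by positivity [sub_pos.2 hp])]
    congr 1
    rw [show p - 2 + 1 = p - 1 by ring]
    rcases (h0 x).eq_or_lt with hx | hx
    · rw [← hx, Real.zero_rpow (by linarith), Real.zero_rpow (by linarith)]
      simp
    · rw [show h x ^ p = h x ^ (p - 1) * h x by rw [← Real.rpow_add_one hx.ne', sub_add_cancel]]
      ring
  · refine Measurable.aemeasurable (Measurable.mul (by fun_prop) (Measurable.ite
      (measurableSet_lt (by fun_prop) (by fun_prop)) (by fun_prop) measurable_const))

/-- By Tonelli the inner integral is that of `y^(p-3)` over `y ≥ h x`, finite for `h x > 0` because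
`p < 2`. -/
theorem lintegral_rpow_mul_lintegral_lower (hm : Measurable h) (h0 : ∀ x, 0 ≤ h x) (hp0 : 1 < p)
    (hp : p < 2) :
    ∫⁻ y in Set.Ioi (0 : ℝ), ENNReal.ofReal (y ^ (p - 3)) *
        ∫⁻ x, (if h x ≤ y then ENNReal.ofReal (h x ^ 2) else 0) ∂m =
      ENNReal.ofReal (1 / (2 - p)) * ∫⁻ x, ENNReal.ofReal (h x ^ p) ∂m := by
  have e : ∀ y : ℝ, ENNReal.ofReal (y ^ (p - 3)) *
      ∫⁻ x, (if h x ≤ y then ENNReal.ofReal (h x ^ 2) else 0) ∂m =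
      ∫⁻ x, ENNReal.ofReal (h x ^ 2) * (if h x ≤ y then ENNReal.ofReal (y ^ (p - 3)) else 0) ∂m := by
    intro y
    rw [← lintegral_const_mul' _ _ ENNReal.ofReal_ne_top]
    refine lintegral_congr fun x => ?_
    split_ifs <;> simp [mul_comm]
  simp_rw [e]
  rw [lintegral_lintegral_swap, ← lintegral_const_mul' _ _ ENNReal.ofReal_ne_top]
  · refine lintegral_congr fun x => ?_
    rw [lintegral_const_mul' _ _ ENNReal.ofReal_ne_top]
    rcases (h0 x).eq_or_lt with hx | hx
    · rw [← hx, Real.zero_rpow (by linarith)]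
      simp
    · rw [setLIntegral_Ioi_ite_le_rpow (by linarith) hx, ← ENNReal.ofReal_mul (by positivity),
        ← ENNReal.ofReal_mul (by positivity [sub_pos.2 hp])]
      congr 1
      rw [show h x ^ p = h x ^ (p - 3 + 1) * h x ^ 2 by
        rw [← Real.rpow_add_natCast hx.ne']
        congr 1
        push_cast
        ring, show -(p - 3 + 1) = 2 - p by ring]
      ring
  · refine Measurable.aemeasurable (Measurable.mul (by fun_prop) (Measurable.ite
      (measurableSet_le (by fun_prop) (by fun_prop)) (by fun_prop) measurable_const))

end Layers

theorem rpow_neg_sub_one_le_sub {ρ x : ℝ} (hρ : 1 ≤ ρ) (hx : 1 ≤ x) :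
    x ^ (-ρ - 1) ≤ 2 * (x ^ (-ρ) - (x + 1) ^ (-ρ)) := by
  have hx0 : 0 < x := by linarith
  have h1 : (x + 1) ^ (-ρ) ≤ x ^ (-ρ) * (x / (x + 1)) := by
    have : (x / (x + 1)) ^ ρ ≤ x / (x + 1) := by
      have := Real.rpow_le_rpow_of_exponent_ge (x := x / (x + 1)) (by positivity)
        ((div_le_one (by positivity)).2 (by linarith)) hρ
      rwa [Real.rpow_one] at this
    calc (x + 1) ^ (-ρ) = x ^ (-ρ) * (x / (x + 1)) ^ ρ := by
          rw [Real.div_rpow hx0.le (by positivity), Real.rpow_neg hx0.le,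
            Real.rpow_neg (by positivity)]
          field_simp
      _ ≤ _ := by gcongr
  have h2 : x ^ (-ρ - 1) = x ^ (-ρ) / x := Real.rpow_sub_one hx0.ne' _
  have h3 : 0 < x ^ (-ρ) := by positivity
  have h4 : x ^ (-ρ) / x ≤ 2 * (x ^ (-ρ) - x ^ (-ρ) * (x / (x + 1))) := by
    rw [show 2 * (x ^ (-ρ) - x ^ (-ρ) * (x / (x + 1))) = x ^ (-ρ) * (2 / (x + 1)) by
      field_simp
      ring, div_eq_mul_inv]
    gcongr
    rw [inv_le_comm₀ hx0 (by positivity), inv_div, div_le_iff₀ two_pos]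
    linarith
  rw [h2]
  linarith

/-- The condition says `(n+1)^(-ρ) < K / a`. The weights are dominated by twice the differences of
`(n+1)^(-ρ)`; capping that sequence at `K / a` makes the whole sum telescope to at most `2K / a`. -/
theorem tsum_ite_lt_mul_rpow_le {ρ a K : ℝ} (hρ : 1 ≤ ρ) (ha : 0 < a) (hK : 0 ≤ K) :
    ∑' n : ℕ, (if a < K * ((n : ℝ) + 1) ^ ρ then ENNReal.ofReal (((n : ℝ) + 1) ^ (-ρ - 1)) else 0) ≤
      ENNReal.ofReal (2 * K / a) := by
  let b : ℕ → ℝ := fun n => min (K / a) (((n : ℝ) + 1) ^ (-ρ))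
  have hb0 : ∀ n, 0 ≤ b n := fun n => le_min (by positivity) (by positivity)
  have hanti : ∀ n : ℕ, ((n : ℝ) + 1 + 1) ^ (-ρ) ≤ ((n : ℝ) + 1) ^ (-ρ) := fun n =>
    Real.rpow_le_rpow_of_nonpos (by positivity) (by linarith) (by linarith)
  have hterm : ∀ n : ℕ,
      (if a < K * ((n : ℝ) + 1) ^ ρ then ENNReal.ofReal (((n : ℝ) + 1) ^ (-ρ - 1)) else 0) ≤
        ENNReal.ofReal (2 * (b n - b (n + 1))) := by
    intro n
    have hn : (1 : ℝ) ≤ n + 1 := by simp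
    split_ifs with h
    · refine ENNReal.ofReal_le_ofReal ((rpow_neg_sub_one_le_sub hρ hn).trans (le_of_eq ?_))
      have h1 : ((n : ℝ) + 1) ^ (-ρ) ≤ K / a := by
        rw [le_div_iff₀ ha, Real.rpow_neg (by positivity), inv_mul_le_iff₀ (by positivity)]
        linarith
      simp only [b]
      push_cast
      rw [min_eq_right h1, min_eq_right ((hanti n).trans h1)]
    · exact zero_le
  rw [ENNReal.tsum_eq_iSup_nat]
  refine iSup_le fun N => (Finset.sum_le_sum fun n _ => hterm n).trans ?_
  rw [← ENNReal.ofReal_sum_of_nonneg]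
  · refine ENNReal.ofReal_le_ofReal ?_
    rw [← Finset.mul_sum, Finset.sum_range_sub', mul_div_assoc]
    have := hb0 N
    have : b 0 ≤ K / a := min_le_left _ _
    linarith
  · intro n _
    have : b (n + 1) ≤ b n := by
      refine min_le_min_left _ ?_
      push_cast
      exact hanti n
    linarith

/-! ### Paley's inequality for orthonormal systems of polynomial growth. -/

noncomputable section

/-- The coefficients of `f` with respect to a system `φ` of real functions. -/
def systemCoeff {Ω : Type*} [MeasurableSpace Ω] (m : Measure Ω) (φ : ℕ → Ω → ℝ) (f : Ω → ℂ)
    (n : ℕ) : ℂ :=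
  ∫ x, f x * (φ n x : ℂ) ∂m

/-- An orthonormal system of real functions with `|φ_n| ≤ M (n+1)^τ` almost everywhere. -/
structure IsGrowthSystem {Ω : Type*} [MeasurableSpace Ω] (m : Measure Ω) (φ : ℕ → Ω → ℝ)
    (M τ : ℝ) : Prop where
  measurable : ∀ n, Measurable (φ n)
  bound : ∀ n, ∀ᵐ x ∂m, |φ n x| ≤ M * ((n : ℝ) + 1) ^ τ
  orthonormal : ∀ i j, ∫ x, φ i x * φ j x ∂m = if i = j then 1 else 0
  bound_nonneg : 0 ≤ M
  exponent_nonneg : 0 ≤ τ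

/-- The general term of the weighted `ℓ_p` sum. -/
def paleyTerm (s p : ℝ) (c : ℕ → ℂ) (n : ℕ) : ℝ :=
  (((n : ℝ) + 1) ^ ((1 / p.conjExponent - 1 / p) * s) * ‖c n‖) ^ p

end

theorem paleyTerm_nonneg (s p : ℝ) (c : ℕ → ℂ) (n : ℕ) : 0 ≤ paleyTerm s p c n := by
  unfold paleyTerm
  positivity

theorem paleyTerm_two (s : ℝ) (c : ℕ → ℂ) (n : ℕ) : paleyTerm s 2 c n = ‖c n‖ ^ 2 := by
  rw [paleyTerm, Real.conjExponent]
  norm_num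

/-- Since `(1/p' - 1/p) s p = -2s + sp`, the weight separates into a mass independent of `p` and a
`p`-th power. This is the form to which interpolation applies. -/
theorem paleyTerm_eq {s p : ℝ} (hp : 1 < p) (c : ℕ → ℂ) (n : ℕ) :
    paleyTerm s p c n = ((n : ℝ) + 1) ^ (-(2 * s)) * (((n : ℝ) + 1) ^ s * ‖c n‖) ^ p := by
  have hn : (0 : ℝ) < n + 1 := by positivity
  rw [paleyTerm, Real.conjExponent, Real.mul_rpow (by positivity) (norm_nonneg _),
    Real.mul_rpow (by positivity) (norm_nonneg _), ← mul_assoc, ← Real.rpow_mul hn.le,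
    ← Real.rpow_mul hn.le, ← Real.rpow_add hn]
  congr 2
  have : p - 1 ≠ 0 := by linarith
  field_simp
  ring

namespace IsGrowthSystem

variable {Ω : Type*} [MeasurableSpace Ω] {m : Measure Ω} {φ : ℕ → Ω → ℝ} {M τ : ℝ}

theorem bound_ofReal (h : IsGrowthSystem m φ M τ) (n : ℕ) :
    ∀ᵐ x ∂m, ‖(φ n x : ℂ)‖ ≤ M * ((n : ℝ) + 1) ^ τ := by
  filter_upwards [h.bound n] with x hx
  rwa [Complex.norm_real]

theorem measurable_ofReal (h : IsGrowthSystem m φ M τ) (n : ℕ) :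
    Measurable fun x => (φ n x : ℂ) :=
  Complex.measurable_ofReal.comp (h.measurable n)

theorem memLp [IsFiniteMeasure m] (h : IsGrowthSystem m φ M τ) (n : ℕ) (p : ENNReal) :
    MemLp (fun x => (φ n x : ℂ)) p m :=
  MemLp.of_bound (h.measurable_ofReal n).aestronglyMeasurable _ (h.bound_ofReal n)

theorem integrable_mul (h : IsGrowthSystem m φ M τ) {f : Ω → ℂ} (hf : Integrable f m) (n : ℕ) :
    Integrable (fun x => f x * (φ n x : ℂ)) m :=
  Integrable.mul_bdd (c := M * ((n : ℝ) + 1) ^ τ) hf (h.measurable_ofReal n).aestronglyMeasurable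
    (h.bound_ofReal n)

theorem systemCoeff_add (h : IsGrowthSystem m φ M τ) {f g : Ω → ℂ} (hf : Integrable f m)
    (hg : Integrable g m) (n : ℕ) :
    systemCoeff m φ (f + g) n = systemCoeff m φ f n + systemCoeff m φ g n := by
  simp only [systemCoeff, Pi.add_apply, add_mul]
  exact integral_add (h.integrable_mul hf n) (h.integrable_mul hg n)

theorem systemCoeff_sub (h : IsGrowthSystem m φ M τ) {f g : Ω → ℂ} (hf : Integrable f m)
    (hg : Integrable g m) (n : ℕ) :
    systemCoeff m φ (f - g) n = systemCoeff m φ f n - systemCoeff m φ g n := by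
  simp only [systemCoeff, Pi.sub_apply, sub_mul]
  exact integral_sub (h.integrable_mul hf n) (h.integrable_mul hg n)

theorem norm_systemCoeff_le (h : IsGrowthSystem m φ M τ) {f : Ω → ℂ} (hf : Integrable f m) (n : ℕ) :
    ‖systemCoeff m φ f n‖ ≤ M * ((n : ℝ) + 1) ^ τ * ∫ x, ‖f x‖ ∂m := by
  rw [← integral_const_mul]
  refine norm_integral_le_of_norm_le (hf.norm.const_mul _) ?_
  filter_upwards [h.bound_ofReal n] with x hx
  rw [norm_mul, mul_comm]
  gcongr

theorem orthonormal_toLp [IsFiniteMeasure m] (h : IsGrowthSystem m φ M τ) :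
    Orthonormal ℂ fun n => (h.memLp n 2).toLp := by
  rw [orthonormal_iff_ite]
  intro i j
  rw [L2.inner_def]
  have e : ∫ x, inner ℂ ((h.memLp i 2).toLp _ x) ((h.memLp j 2).toLp _ x) ∂m =
      ∫ x, ((φ i x * φ j x : ℝ) : ℂ) ∂m := by
    refine integral_congr_ae ?_
    filter_upwards [(h.memLp i 2).coeFn_toLp, (h.memLp j 2).coeFn_toLp] with x hi hj
    rw [hi, hj]
    simp [mul_comm]
  rw [e, integral_complex_ofReal, h.orthonormal]
  split_ifs <;> simp

theorem systemCoeff_eq_inner [IsFiniteMeasure m] (h : IsGrowthSystem m φ M τ) {f : Ω → ℂ}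
    (hf : MemLp f 2 m) (n : ℕ) :
    systemCoeff m φ f n = inner ℂ (h.memLp n 2).toLp hf.toLp := by
  rw [L2.inner_def]
  refine integral_congr_ae ?_
  filter_upwards [(h.memLp n 2).coeFn_toLp, hf.coeFn_toLp] with x hn hx
  rw [hn, hx]
  simp

/-- Bessel's inequality, the strong (2,2) end point. -/
theorem tsum_ofReal_sq_le [IsFiniteMeasure m] (h : IsGrowthSystem m φ M τ) {f : Ω → ℂ}
    (hf : MemLp f 2 m) :
    ∑' n, ENNReal.ofReal (‖systemCoeff m φ f n‖ ^ 2) ≤ ∫⁻ x, ENNReal.ofReal (‖f x‖ ^ 2) ∂m := by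
  have h1 := h.orthonormal_toLp.tsum_inner_products_le (x := hf.toLp)
  have h2 := h.orthonormal_toLp.inner_products_summable (x := hf.toLp)
  simp only [← h.systemCoeff_eq_inner hf] at h1 h2
  rw [← ENNReal.ofReal_tsum_of_nonneg (fun n => by positivity) h2]
  refine (ENNReal.ofReal_le_ofReal h1).trans (le_of_eq ?_)
  have h3 := eLpNorm_nnreal_pow_eq_lintegral (f := f) (μ := m) (p := 2) two_ne_zero
  rw [Lp.norm_toLp, ENNReal.ofReal_pow ENNReal.toReal_nonneg, ENNReal.ofReal_toReal hf.eLpNorm_ne_top]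
  norm_num at h3
  rw [h3]
  refine lintegral_congr fun x => ?_
  rw [ENNReal.ofReal_pow (norm_nonneg _), ofReal_norm]

/-- The weak (1,1) end point. Since `|c_n| ≤ M (n+1)^τ ‖f‖₁`, only indices with `a < M ‖f‖₁
(n+1)^(2τ+1)` contribute, and their masses have a tail sum of order `M ‖f‖₁ / a`. -/
theorem tsum_weight_ite_lt_le (h : IsGrowthSystem m φ M τ) {f : Ω → ℂ} (hf : Integrable f m) {a : ℝ}
    (ha : 0 < a) :
    ∑' n : ℕ, (if a < ((n : ℝ) + 1) ^ (τ + 1) * ‖systemCoeff m φ f n‖ then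
      ENNReal.ofReal (((n : ℝ) + 1) ^ (-(2 * (τ + 1)))) else 0) ≤
      ENNReal.ofReal (2 * M / a) * ∫⁻ x, ENNReal.ofReal ‖f x‖ ∂m := by
  have h0 := h.bound_nonneg
  have hI : 0 ≤ ∫ x, ‖f x‖ ∂m := integral_nonneg fun x => norm_nonneg _
  rw [← ofReal_integral_eq_lintegral_ofReal hf.norm (Eventually.of_forall fun x => norm_nonneg _),
    ← ENNReal.ofReal_mul (by positivity)]
  have := tsum_ite_lt_mul_rpow_le (ρ := 2 * τ + 1) (K := M * ∫ x, ‖f x‖ ∂m)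
    (by linarith [h.exponent_nonneg]) ha (by positivity)
  rw [show 2 * (M * ∫ x, ‖f x‖ ∂m) / a = 2 * M / a * ∫ x, ‖f x‖ ∂m by ring] at this
  refine le_trans (ENNReal.tsum_le_tsum fun n => ?_) this
  have hn : (0 : ℝ) < n + 1 := by positivity
  rw [show -(2 * (τ + 1)) = -(2 * τ + 1) - 1 by ring]
  split_ifs with h1 h2 h2
  · exact le_rfl
  · exfalso
    refine h2 (h1.trans_le ?_)
    have := h.norm_systemCoeff_le hf n
    calc ((n : ℝ) + 1) ^ (τ + 1) * ‖systemCoeff m φ f n‖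
        ≤ ((n : ℝ) + 1) ^ (τ + 1) * (M * ((n : ℝ) + 1) ^ τ * ∫ x, ‖f x‖ ∂m) := by gcongr
      _ = M * (∫ x, ‖f x‖ ∂m) * (((n : ℝ) + 1) ^ (τ + 1) * ((n : ℝ) + 1) ^ τ) := by ring
      _ = _ := by
        rw [← Real.rpow_add hn]
        ring_nf
  · exact zero_le
  · exact le_rfl

/-- The distribution function estimate obtained by truncating `f` at height `y`. -/
theorem tsum_weight_ite_lt_le_add [IsFiniteMeasure m] (h : IsGrowthSystem m φ M τ) {f : Ω → ℂ}
    (hm : StronglyMeasurable f) (hf : Integrable f m) {y : ℝ} (hy : 0 < y) :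
    ∑' n : ℕ, (if y < ((n : ℝ) + 1) ^ (τ + 1) * ‖systemCoeff m φ f n‖ then
      ENNReal.ofReal (((n : ℝ) + 1) ^ (-(2 * (τ + 1)))) else 0) ≤
      ENNReal.ofReal (4 * M / y) * (∫⁻ x, (if y < ‖f x‖ then ENNReal.ofReal ‖f x‖ else 0) ∂m) +
      ENNReal.ofReal (4 / y ^ 2) *
        ∫⁻ x, (if ‖f x‖ ≤ y then ENNReal.ofReal (‖f x‖ ^ 2) else 0) ∂m := by
  set s : Set Ω := {x | y < ‖f x‖}
  have hs : MeasurableSet s := measurableSet_lt measurable_const hm.measurable.norm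
  have hf1 : Integrable (s.indicator f) m := hf.indicator hs
  have hf2 : MemLp (sᶜ.indicator f) 2 m := by
    refine MemLp.of_bound (hm.indicator hs.compl).aestronglyMeasurable y
      (Eventually.of_forall fun x => ?_)
    by_cases hx : x ∈ s
    · simp [hx, hy.le]
    · simp only [Set.mem_compl_iff, hx, not_false_eq_true, Set.indicator_of_mem]
      exact not_lt.1 hx
  have hc : ∀ n, ‖systemCoeff m φ f n‖ ≤
      ‖systemCoeff m φ (s.indicator f) n‖ + ‖systemCoeff m φ (sᶜ.indicator f) n‖ := fun n => by
    conv_lhs => rw [← Set.indicator_self_add_compl s f]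
    rw [h.systemCoeff_add hf1 (hf2.integrable one_le_two)]
    exact norm_add_le _ _
  have e1 : ∫⁻ x, (if y < ‖f x‖ then ENNReal.ofReal ‖f x‖ else 0) ∂m =
      ∫⁻ x, ENNReal.ofReal ‖s.indicator f x‖ ∂m := by
    refine lintegral_congr fun x => ?_
    by_cases hx : x ∈ s
    · simp only [hx, Set.indicator_of_mem]
      exact if_pos hx
    · simp only [hx, not_false_eq_true, Set.indicator_of_notMem, norm_zero, ENNReal.ofReal_zero]
      exact if_neg hx
  have e2 : ∫⁻ x, (if ‖f x‖ ≤ y then ENNReal.ofReal (‖f x‖ ^ 2) else 0) ∂m =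
      ∫⁻ x, ENNReal.ofReal (‖sᶜ.indicator f x‖ ^ 2) ∂m := by
    refine lintegral_congr fun x => ?_
    by_cases hx : x ∈ s
    · have : ¬ ‖f x‖ ≤ y := not_le.2 hx
      simp [hx, this]
    · have : ‖f x‖ ≤ y := not_lt.1 hx
      simp [hx, this]
  -- If the sum of the two contributions exceeds `y`, one of them exceeds `y / 2`. The large part of
  -- `f` is treated by the weak estimate, the bounded part by Chebyshev and Bessel.
  have b1 := h.tsum_weight_ite_lt_le hf1 (half_pos hy)
  have b2 := h.tsum_ofReal_sq_le hf2
  rw [e1, e2, show 4 * M / y = 2 * M / (y / 2) by field_simp; ring]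
  refine le_trans ?_ (add_le_add b1 (mul_le_mul_right b2 _))
  rw [← ENNReal.tsum_mul_left, ← ENNReal.tsum_add]
  refine ENNReal.tsum_le_tsum fun n => ?_
  have hn : (0 : ℝ) < n + 1 := by positivity
  set u := ‖systemCoeff m φ (s.indicator f) n‖
  set v := ‖systemCoeff m φ (sᶜ.indicator f) n‖
  have hw := Real.rpow_pos_of_pos hn (τ + 1)
  have hw2 : ((n : ℝ) + 1) ^ (-(2 * (τ + 1))) = ((((n : ℝ) + 1) ^ (τ + 1)) ^ 2)⁻¹ := by
    rw [Real.rpow_neg hn.le, mul_comm 2 (τ + 1), Real.rpow_mul hn.le, Real.rpow_two]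
  rw [hw2]
  set w := ((n : ℝ) + 1) ^ (τ + 1)
  split_ifs with h1 h2 h2
  · exact le_self_add
  · rw [zero_add, ← ENNReal.ofReal_mul (by positivity)]
    refine ENNReal.ofReal_le_ofReal ?_
    have h3 : y / 2 < w * v := by
      have := mul_le_mul_of_nonneg_left (hc n) hw.le
      linarith [not_lt.1 h2]
    rw [div_mul_eq_mul_div, le_div_iff₀ (by positivity), inv_mul_le_iff₀ (by positivity)]
    have : (y / 2) ^ 2 ≤ (w * v) ^ 2 := by gcongr
    linarith
  · exact zero_le
  · exact zero_le

end IsGrowthSystem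

noncomputable section

/-- The `p`-th power of the constant in Paley's inequality. -/
def paleyConst (M p : ℝ) : ℝ :=
  if p = 2 then 1 else 4 * M * p / (p - 1) + 4 * p / (2 - p)

end

theorem paleyConst_nonneg {M p : ℝ} (hM : 0 ≤ M) (hp : 1 < p) (hp2 : p ≤ 2) :
    0 ≤ paleyConst M p := by
  unfold paleyConst
  have h1 : 0 ≤ p - 1 := by linarith
  have h2 : 0 ≤ 2 - p := by linarith
  split_ifs <;> positivity

theorem eLpNorm_ofReal_rpow {Ω E : Type*} [MeasurableSpace Ω] [NormedAddCommGroup E]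
    {m : Measure Ω} {p : ℝ} (hp : 0 < p) (f : Ω → E) :
    eLpNorm f (ENNReal.ofReal p) m ^ p = ∫⁻ x, ENNReal.ofReal (‖f x‖ ^ p) ∂m := by
  have h := eLpNorm_nnreal_pow_eq_lintegral (f := f) (μ := m) (p := p.toNNReal)
    (Real.toNNReal_pos.2 hp).ne'
  rw [Real.coe_toNNReal p hp.le] at h
  refine h.trans (lintegral_congr fun x => ?_)
  rw [← ENNReal.ofReal_rpow_of_nonneg (norm_nonneg _) hp.le, ofReal_norm]

namespace IsGrowthSystem

variable {Ω : Type*} [MeasurableSpace Ω] {m : Measure Ω} {φ : ℕ → Ω → ℝ} {M τ : ℝ}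

theorem tsum_paleyTerm_le_of_lt_two [IsFiniteMeasure m] (h : IsGrowthSystem m φ M τ) {f : Ω → ℂ}
    (hm : StronglyMeasurable f) (hf : Integrable f m) {p : ℝ} (hp : 1 < p) (hp2 : p < 2) :
    ∑' n, ENNReal.ofReal (paleyTerm (τ + 1) p (systemCoeff m φ f) n) ≤
      ENNReal.ofReal (4 * M * p / (p - 1) + 4 * p / (2 - p)) *
        ∫⁻ x, ENNReal.ofReal (‖f x‖ ^ p) ∂m := by
  have hp0 : 0 < p := by linarith
  have hp1 : 0 < p - 1 := by linarith
  have hp3 : 0 < 2 - p := by linarith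
  have hM := h.bound_nonneg
  set G : ℕ → ℝ := fun n => ((n : ℝ) + 1) ^ (τ + 1) * ‖systemCoeff m φ f n‖ with hG
  have hG0 : ∀ n, 0 ≤ G n := fun n => by positivity
  -- Layer-cake formula: `G^p` is the integral of `p y^(p-1)` over `0 < y < G`.
  have e : ∀ n : ℕ, ENNReal.ofReal (paleyTerm (τ + 1) p (systemCoeff m φ f) n) =
      ∫⁻ y in Set.Ioi (0 : ℝ), ENNReal.ofReal p * ENNReal.ofReal (y ^ (p - 1)) *
        (if y < G n then ENNReal.ofReal (((n : ℝ) + 1) ^ (-(2 * (τ + 1)))) else 0) := by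
    intro n
    have h1 : ∀ y : ℝ, ENNReal.ofReal p * ENNReal.ofReal (y ^ (p - 1)) *
        (if y < G n then ENNReal.ofReal (((n : ℝ) + 1) ^ (-(2 * (τ + 1)))) else 0) =
        ENNReal.ofReal p * ENNReal.ofReal (((n : ℝ) + 1) ^ (-(2 * (τ + 1)))) *
          (if y < G n then ENNReal.ofReal (y ^ (p - 1)) else 0) := fun y => by
      split_ifs
      · ring
      · simp
    simp_rw [h1]
    rw [lintegral_const_mul' _ _ (by finiteness), setLIntegral_Ioi_ite_lt_rpow (by linarith) (hG0 n),
      ← ENNReal.ofReal_mul hp0.le, ← ENNReal.ofReal_mul (by positivity), paleyTerm_eq hp,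
      sub_add_cancel]
    congr 1
    simp only [hG]
    field_simp
  simp_rw [e]
  rw [← lintegral_tsum]
  swap
  · intro n
    refine Measurable.aemeasurable (Measurable.mul (by fun_prop) (Measurable.ite
      (measurableSet_lt (by fun_prop) (by fun_prop)) (by fun_prop) measurable_const))
  set U : ℝ → ENNReal := fun y => ∫⁻ x, (if y < ‖f x‖ then ENNReal.ofReal ‖f x‖ else 0) ∂m
  set V : ℝ → ENNReal := fun y =>
    ∫⁻ x, (if ‖f x‖ ≤ y then ENNReal.ofReal (‖f x‖ ^ 2) else 0) ∂m
  have hb : ∀ y ∈ Set.Ioi (0 : ℝ), ∑' n : ℕ, ENNReal.ofReal p * ENNReal.ofReal (y ^ (p - 1)) *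
      (if y < G n then ENNReal.ofReal (((n : ℝ) + 1) ^ (-(2 * (τ + 1)))) else 0) ≤
      ENNReal.ofReal (4 * M * p) * (ENNReal.ofReal (y ^ (p - 2)) * U y) +
        ENNReal.ofReal (4 * p) * (ENNReal.ofReal (y ^ (p - 3)) * V y) := by
    intro y hy
    have hy : 0 < y := hy
    have e1 : y ^ (p - 1) = y ^ (p - 2) * y := by
      rw [← Real.rpow_add_one hy.ne']
      ring_nf
    have e2 : y ^ (p - 1) = y ^ (p - 3) * y ^ 2 := by
      rw [← Real.rpow_add_natCast hy.ne']
      congr 1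
      push_cast
      ring
    rw [ENNReal.tsum_mul_left]
    refine (mul_le_mul_right (h.tsum_weight_ite_lt_le_add hm hf hy) _).trans (le_of_eq ?_)
    rw [mul_add]
    simp only [← mul_assoc]
    rw [← ENNReal.ofReal_mul (by positivity), ← ENNReal.ofReal_mul (by positivity),
      ← ENNReal.ofReal_mul (by positivity), ← ENNReal.ofReal_mul (by positivity),
      ← ENNReal.ofReal_mul (by positivity)]
    congr 3
    · rw [e1]
      field_simp
    · rw [e2]
      field_simp
  refine (setLIntegral_mono' measurableSet_Ioi hb).trans ?_
  rw [lintegral_add_left, lintegral_const_mul' _ _ (by finiteness),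
    lintegral_const_mul' _ _ (by finiteness),
    lintegral_rpow_mul_lintegral_upper hm.measurable.norm (fun x => norm_nonneg _) hp,
    lintegral_rpow_mul_lintegral_lower hm.measurable.norm (fun x => norm_nonneg _) hp hp2,
    ← mul_assoc, ← mul_assoc, ← ENNReal.ofReal_mul (by positivity),
    ← ENNReal.ofReal_mul (by positivity), ← add_mul, ← ENNReal.ofReal_add (by positivity)
    (by positivity), mul_one_div, mul_one_div]
  exact Measurable.const_mul (Measurable.mul (by fun_prop)
    (measurable_lintegral_upper hm.measurable.norm)) _

theorem tsum_paleyTerm_le [IsFiniteMeasure m] (h : IsGrowthSystem m φ M τ) {f : Ω → ℂ} {p : ℝ}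
    (hp : 1 < p) (hp2 : p ≤ 2) (hf : MemLp f (ENNReal.ofReal p) m) :
    ∑' n, ENNReal.ofReal (paleyTerm (τ + 1) p (systemCoeff m φ f) n) ≤
      ENNReal.ofReal (paleyConst M p) * eLpNorm f (ENNReal.ofReal p) m ^ p := by
  rw [eLpNorm_ofReal_rpow (by linarith)]
  rcases hp2.eq_or_lt with rfl | hp2
  · simp only [paleyTerm_two, paleyConst, if_pos, ENNReal.ofReal_one, one_mul, Real.rpow_two]
    refine h.tsum_ofReal_sq_le ?_
    rwa [ENNReal.ofReal_ofNat] at hf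
  -- Truncation needs a measurable level set, hence a strongly measurable representative.
  · obtain ⟨g, hg, hfg⟩ := hf.1
    have h1 : systemCoeff m φ f = systemCoeff m φ g := by
      funext n
      refine integral_congr_ae ?_
      filter_upwards [hfg] with x hx
      rw [hx]
    have h2 : ∫⁻ x, ENNReal.ofReal (‖f x‖ ^ p) ∂m = ∫⁻ x, ENNReal.ofReal (‖g x‖ ^ p) ∂m := by
      refine lintegral_congr_ae ?_
      filter_upwards [hfg] with x hx
      rw [hx]
    rw [h1, h2, paleyConst, if_neg hp2.ne]
    exact h.tsum_paleyTerm_le_of_lt_two hg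
      ((hf.integrable (ENNReal.one_le_ofReal.2 hp.le)).congr hfg) hp hp2

/-- Paley's inequality. -/
theorem paley [IsFiniteMeasure m] (h : IsGrowthSystem m φ M τ) {f : Ω → ℂ} {p : ℝ}
    (hp : 1 < p) (hp2 : p ≤ 2) (hf : MemLp f (ENNReal.ofReal p) m) :
    Summable (paleyTerm (τ + 1) p (systemCoeff m φ f)) ∧
      (∑' n, paleyTerm (τ + 1) p (systemCoeff m φ f) n) ^ (1 / p) ≤
        paleyConst M p ^ (1 / p) * (eLpNorm f (ENNReal.ofReal p) m).toReal := by
  have hB := paleyConst_nonneg h.bound_nonneg hp hp2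
  have hp0 : 0 < p := by linarith
  have hle := h.tsum_paleyTerm_le hp hp2 hf
  have hnn := paleyTerm_nonneg (τ + 1) p (systemCoeff m φ f)
  have htop : ENNReal.ofReal (paleyConst M p) * eLpNorm f (ENNReal.ofReal p) m ^ p ≠ ⊤ :=
    ENNReal.mul_ne_top ENNReal.ofReal_ne_top
      (ENNReal.rpow_ne_top_of_nonneg hp0.le hf.eLpNorm_ne_top)
  have hs : Summable (paleyTerm (τ + 1) p (systemCoeff m φ f)) := by
    have := ENNReal.summable_toReal (ne_top_of_le_ne_top htop hle)
    simpa only [ENNReal.toReal_ofReal (hnn _)] using this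
  refine ⟨hs, ?_⟩
  rw [← ENNReal.ofReal_tsum_of_nonneg hnn hs] at hle
  have := ENNReal.toReal_mono htop hle
  rw [ENNReal.toReal_ofReal (tsum_nonneg hnn), ENNReal.toReal_mul, ENNReal.toReal_ofReal hB,
    ← ENNReal.toReal_rpow] at this
  refine (Real.rpow_le_rpow (tsum_nonneg hnn) this (by positivity)).trans (le_of_eq ?_)
  rw [Real.mul_rpow hB (by positivity), ← Real.rpow_mul ENNReal.toReal_nonneg, mul_one_div,
    div_self hp0.ne', Real.rpow_one]

end IsGrowthSystem

/-! ### The dual inequality and convergence of the series. -/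

noncomputable section

/-- Finite sums `∑_{n ∈ S} c_n φ_n`. -/
def systemSum {Ω : Type*} (φ : ℕ → Ω → ℝ) (c : ℕ → ℂ) (S : Finset ℕ) (x : Ω) : ℂ :=
  ∑ n ∈ S, c n * (φ n x : ℂ)

end

namespace IsGrowthSystem

variable {Ω : Type*} [MeasurableSpace Ω] {m : Measure Ω} {φ : ℕ → Ω → ℝ} {M τ : ℝ}

theorem measurable_systemSum (h : IsGrowthSystem m φ M τ) (c : ℕ → ℂ) (S : Finset ℕ) :
    Measurable (systemSum φ c S) :=
  Finset.measurable_fun_sum S fun n _ => (h.measurable_ofReal n).const_mul (c n)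

theorem exists_bound_systemSum (h : IsGrowthSystem m φ M τ) (c : ℕ → ℂ) (S : Finset ℕ) :
    ∃ K, ∀ᵐ x ∂m, ‖systemSum φ c S x‖ ≤ K := by
  refine ⟨∑ n ∈ S, ‖c n‖ * (M * ((n : ℝ) + 1) ^ τ), ?_⟩
  filter_upwards [ae_all_iff.2 h.bound_ofReal] with x hx
  refine (norm_sum_le _ _).trans (Finset.sum_le_sum fun n _ => ?_)
  rw [norm_mul]
  gcongr
  exact hx n

theorem memLp_systemSum [IsFiniteMeasure m] (h : IsGrowthSystem m φ M τ) (c : ℕ → ℂ)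
    (S : Finset ℕ) (p : ENNReal) : MemLp (systemSum φ c S) p m := by
  obtain ⟨K, hK⟩ := h.exists_bound_systemSum c S
  exact MemLp.of_bound (h.measurable_systemSum c S).aestronglyMeasurable K hK

theorem integral_systemSum_mul (h : IsGrowthSystem m φ M τ) {g : Ω → ℂ} (hg : Integrable g m)
    (c : ℕ → ℂ) (S : Finset ℕ) :
    ∫ x, systemSum φ c S x * g x ∂m = ∑ n ∈ S, c n * systemCoeff m φ g n := by
  simp only [systemSum, Finset.sum_mul, systemCoeff]
  rw [integral_finsetSum]
  · refine Finset.sum_congr rfl fun n _ => ?_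
    rw [← integral_const_mul]
    refine integral_congr_ae (Eventually.of_forall fun x => ?_)
    ring
  · intro n _
    refine ((h.integrable_mul hg n).const_mul (c n)).congr (Eventually.of_forall fun x => ?_)
    ring

theorem systemCoeff_systemSum [IsFiniteMeasure m] (h : IsGrowthSystem m φ M τ) (c : ℕ → ℂ)
    {S : Finset ℕ} {n : ℕ} (hn : n ∈ S) : systemCoeff m φ (systemSum φ c S) n = c n := by
  have h1 : ∀ k, systemCoeff m φ (fun x => (φ n x : ℂ)) k = if k = n then 1 else 0 := by
    intro k
    have : ∫ x, (φ n x : ℂ) * (φ k x : ℂ) ∂m = ∫ x, ((φ k x * φ n x : ℝ) : ℂ) ∂m :=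
      integral_congr_ae (Eventually.of_forall fun x => by
        push_cast
        ring)
    rw [systemCoeff, this, integral_complex_ofReal, h.orthonormal]
    split_ifs <;> simp
  rw [systemCoeff, h.integral_systemSum_mul ((h.memLp n 1).integrable le_rfl)]
  simp [h1, hn]

theorem toReal_eLpNorm_systemSum_le [IsFiniteMeasure m] (h : IsGrowthSystem m φ M τ) {q : ℝ}
    (hq : 2 ≤ q) (c : ℕ → ℂ) (S : Finset ℕ) :
    (eLpNorm (systemSum φ c S) (ENNReal.ofReal q) m).toReal ≤
      paleyConst M q.conjExponent ^ (1 / q.conjExponent) *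
        (∑ n ∈ S, paleyTerm (τ + 1) q c n) ^ (1 / q) := by
  set p := q.conjExponent with hp
  have hqp : q.HolderConjugate p := Real.HolderConjugate.conjExponent (by linarith)
  have hp1 : 1 < p := hqp.symm.lt
  have hp2 : p ≤ 2 := by
    rw [hp, Real.conjExponent, div_le_iff₀ (by linarith)]
    linarith
  have hpc : p.conjExponent = q := hqp.symm.conjExponent_eq
  have hq0 : 0 < q := by linarith
  have hp0 : 0 < p := by linarith
  have hB := paleyConst_nonneg h.bound_nonneg hp1 hp2
  set Φ := systemSum φ c S
  obtain ⟨K, hK⟩ := h.exists_bound_systemSum c S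
  have hΦm : Measurable Φ := h.measurable_systemSum c S
  -- The extremal function in Hölder's inequality: `Φ g = |Φ|^q` and `|g|^p = |Φ|^q`, so the `L_p`
  -- norm of `g` is `N^(q-1)`.
  let g : Ω → ℂ := fun x => (starRingEnd ℂ) (Φ x) * ((‖Φ x‖ ^ (q - 2) : ℝ) : ℂ)
  have hgm : Measurable g := by
    refine Measurable.mul (Complex.continuous_conj.measurable.comp hΦm)
      (Complex.measurable_ofReal.comp (hΦm.norm.pow_const _))
  have hgn : ∀ x, ‖g x‖ = ‖Φ x‖ ^ (q - 1) := fun x => by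
    simp only [g]
    rw [norm_mul, RCLike.norm_conj, Complex.norm_real, Real.norm_of_nonneg (by positivity)]
    rcases (norm_nonneg (Φ x)).eq_or_lt with h0 | h0
    · rw [← h0, Real.zero_rpow (by linarith : q - 1 ≠ 0), zero_mul]
    · rw [mul_comm, ← Real.rpow_add_one h0.ne']
      ring_nf
  have hg : ∀ r : ENNReal, MemLp g r m := fun r => by
    refine MemLp.of_bound hgm.aestronglyMeasurable (K ^ (q - 1)) ?_
    filter_upwards [hK] with x hx
    rw [hgn]
    exact Real.rpow_le_rpow (norm_nonneg _) hx (by linarith)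
  have hΦg : ∀ x, Φ x * g x = ((‖Φ x‖ ^ q : ℝ) : ℂ) := fun x => by
    simp only [g]
    rw [← mul_assoc, Complex.mul_conj, Complex.normSq_eq_norm_sq, ← Complex.ofReal_mul]
    congr 1
    rcases (norm_nonneg (Φ x)).eq_or_lt with h0 | h0
    · rw [← h0, Real.zero_rpow (by linarith : q ≠ 0)]
      simp
    · rw [mul_comm, ← Real.rpow_add_natCast h0.ne']
      congr 1
      push_cast
      ring
  set N := (eLpNorm Φ (ENNReal.ofReal q) m).toReal with hN
  have hN0 : 0 ≤ N := ENNReal.toReal_nonneg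
  have hNq : N ^ q = ∫ x, ‖Φ x‖ ^ q ∂m := by
    rw [hN, ENNReal.toReal_rpow, eLpNorm_ofReal_rpow hq0, integral_eq_lintegral_of_nonneg_ae
      (Eventually.of_forall fun x => by positivity)
      (hΦm.norm.pow_const _).aestronglyMeasurable]
  have hgN : (eLpNorm g (ENNReal.ofReal p) m).toReal = N ^ (q - 1) := by
    have h1 : eLpNorm g (ENNReal.ofReal p) m ^ p = eLpNorm Φ (ENNReal.ofReal q) m ^ q := by
      rw [eLpNorm_ofReal_rpow hq0, eLpNorm_ofReal_rpow hp0]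
      refine lintegral_congr fun x => ?_
      rw [hgn, ← Real.rpow_mul (norm_nonneg _), hqp.sub_one_mul_conj]
    have h2 := congrArg ENNReal.toReal h1
    rw [← ENNReal.toReal_rpow, ← ENNReal.toReal_rpow, ← hN,
      show N ^ q = (N ^ (q - 1)) ^ p by rw [← Real.rpow_mul hN0, hqp.sub_one_mul_conj]] at h2
    exact (Real.rpow_left_inj ENNReal.toReal_nonneg (by positivity) hp0.ne').1 h2
  obtain ⟨hs, hpal⟩ := h.paley hp1 hp2 (hg (ENNReal.ofReal p))
  rw [hgN] at hpal
  have hsum : N ^ q ≤ ∑ n ∈ S, ‖c n‖ * ‖systemCoeff m φ g n‖ := by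
    have h1 := h.integral_systemSum_mul ((hg 1).integrable le_rfl) c S
    have h2 : ∫ x, systemSum φ c S x * g x ∂m = ((N ^ q : ℝ) : ℂ) := by
      rw [hNq, ← integral_complex_ofReal]
      exact integral_congr_ae (Eventually.of_forall hΦg)
    have h3 : N ^ q = ‖∑ n ∈ S, c n * systemCoeff m φ g n‖ := by
      rw [← h1, h2, Complex.norm_real, Real.norm_of_nonneg (by positivity)]
    rw [h3]
    refine (norm_sum_le _ _).trans (le_of_eq ?_)
    simp only [norm_mul]
  have hhol : ∑ n ∈ S, ‖c n‖ * ‖systemCoeff m φ g n‖ ≤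
      (∑ n ∈ S, paleyTerm (τ + 1) q c n) ^ (1 / q) *
        (∑ n ∈ S, paleyTerm (τ + 1) p (systemCoeff m φ g) n) ^ (1 / p) := by
    refine le_trans (le_of_eq ?_) (Real.inner_le_Lp_mul_Lq_of_nonneg S hqp
      (f := fun n => ((n : ℝ) + 1) ^ ((1 / q.conjExponent - 1 / q) * (τ + 1)) * ‖c n‖)
      (g := fun n => ((n : ℝ) + 1) ^ ((1 / p.conjExponent - 1 / p) * (τ + 1)) *
        ‖systemCoeff m φ g n‖) (fun n _ => by positivity) (fun n _ => by positivity))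
    refine Finset.sum_congr rfl fun n _ => ?_
    have hn : (0 : ℝ) < n + 1 := by positivity
    -- The weight exponents for `p` and `q` are opposite, so the weights cancel in the product.
    rw [mul_mul_mul_comm, ← Real.rpow_add hn, hpc, ← hp, ← add_mul]
    simp
  have hfin : (∑ n ∈ S, paleyTerm (τ + 1) p (systemCoeff m φ g) n) ^ (1 / p) ≤
      paleyConst M p ^ (1 / p) * N ^ (q - 1) := by
    refine le_trans ?_ hpal
    have := hs.sum_le_tsum S fun n _ => paleyTerm_nonneg _ _ _ n
    exact Real.rpow_le_rpow (Finset.sum_nonneg fun n _ => paleyTerm_nonneg _ _ _ n) this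
      (by positivity)
  have hR : 0 ≤ (∑ n ∈ S, paleyTerm (τ + 1) q c n) ^ (1 / q) :=
    Real.rpow_nonneg (Finset.sum_nonneg fun n _ => paleyTerm_nonneg _ _ _ n) _
  -- The final bound arises by cancelling `N^(q-1)`, which requires `N > 0`.
  rcases hN0.eq_or_lt with h0 | h0
  · rw [← h0]
    positivity
  · have h1 : N * N ^ (q - 1) ≤ paleyConst M p ^ (1 / p) *
        (∑ n ∈ S, paleyTerm (τ + 1) q c n) ^ (1 / q) * N ^ (q - 1) := by
      calc N * N ^ (q - 1) = N ^ q := by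
            rw [mul_comm, ← Real.rpow_add_one h0.ne', sub_add_cancel]
        _ ≤ _ := hsum.trans hhol
        _ ≤ (∑ n ∈ S, paleyTerm (τ + 1) q c n) ^ (1 / q) *
              (paleyConst M p ^ (1 / p) * N ^ (q - 1)) := by gcongr
        _ = _ := by ring
    exact le_of_mul_le_mul_right h1 (by positivity)

/-- The dual of Paley's inequality. -/
theorem exists_limit_systemSum [IsFiniteMeasure m] (h : IsGrowthSystem m φ M τ) {q : ℝ}
    (hq : 2 ≤ q) {c : ℕ → ℂ} (hc : Summable (paleyTerm (τ + 1) q c)) :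
    ∃ f : Ω → ℂ, MemLp f (ENNReal.ofReal q) m ∧
      Tendsto (fun N : ℕ => eLpNorm (fun x => systemSum φ c (Finset.range (N + 1)) x - f x)
        (ENNReal.ofReal q) m) atTop (𝓝 0) ∧
      (∀ n, systemCoeff m φ f n = c n) ∧
      (eLpNorm f (ENNReal.ofReal q) m).toReal ≤
        paleyConst M q.conjExponent ^ (1 / q.conjExponent) *
          (∑' n, paleyTerm (τ + 1) q c n) ^ (1 / q) := by
  have hq1 : 1 ≤ ENNReal.ofReal q := ENNReal.one_le_ofReal.2 (by linarith)
  have : Fact (1 ≤ ENNReal.ofReal q) := ⟨hq1⟩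
  have hq0 : 0 < q := by linarith
  set A := paleyConst M q.conjExponent ^ (1 / q.conjExponent)
  have hnn := paleyTerm_nonneg (τ + 1) q c
  have hA : 0 ≤ A := by
    have hqp : q.HolderConjugate q.conjExponent := Real.HolderConjugate.conjExponent (by linarith)
    refine Real.rpow_nonneg (paleyConst_nonneg h.bound_nonneg hqp.symm.lt ?_) _
    rw [Real.conjExponent, div_le_iff₀ (by linarith)]
    linarith
  let F : ℕ → Lp ℂ (ENNReal.ofReal q) m := fun N =>
    (h.memLp_systemSum c (Finset.range (N + 1)) (ENNReal.ofReal q)).toLp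
  -- A difference of partial sums is a block sum, bounded by the tail of the convergent series.
  have hF : CauchySeq F := by
    refine cauchySeq_of_le_tendsto_0'
      (fun N => A * (∑' n, paleyTerm (τ + 1) q c (n + (N + 1))) ^ (1 / q)) (fun N N' hN => ?_) ?_
    · rw [dist_comm, dist_eq_norm, ← MemLp.toLp_sub, Lp.norm_toLp]
      have e : systemSum φ c (Finset.range (N' + 1)) - systemSum φ c (Finset.range (N + 1)) =
          systemSum φ c (Finset.Ico (N + 1) (N' + 1)) := by
        funext x
        exact (Finset.sum_Ico_eq_sub _ (by omega)).symm
      rw [e]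
      refine (h.toReal_eLpNorm_systemSum_le hq c _).trans ?_
      gcongr
      · exact Finset.sum_nonneg fun n _ => hnn n
      · rw [Finset.sum_Ico_eq_sum_range]
        simp only [add_comm (N + 1)]
        exact ((summable_nat_add_iff (N + 1)).2 hc).sum_le_tsum _ fun n _ => hnn _
    · have h1 := (tendsto_sum_nat_add (paleyTerm (τ + 1) q c)).comp (tendsto_add_atTop_nat 1)
      have h2 := (h1.rpow_const (p := 1 / q) (Or.inr (by positivity))).const_mul A
      rw [Real.zero_rpow (by positivity), mul_zero] at h2
      exact h2
  obtain ⟨f, hf⟩ := cauchySeq_tendsto_of_complete hF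
  have hconv : Tendsto (fun N : ℕ => eLpNorm (systemSum φ c (Finset.range (N + 1)) - ⇑f)
      (ENNReal.ofReal q) m) atTop (𝓝 0) := by
    rw [← Lp.tendsto_Lp_iff_tendsto_eLpNorm'' _
      (fun N => h.memLp_systemSum c (Finset.range (N + 1)) _) _ (Lp.memLp f), Lp.toLp_coeFn]
    exact hf
  refine ⟨f, Lp.memLp f, hconv, fun n => ?_, ?_⟩
  · have hfi : Integrable (⇑f) m := (Lp.memLp f).integrable hq1
    have hΦi : ∀ N : ℕ, Integrable (systemSum φ c (Finset.range (N + 1))) m := fun N =>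
      (h.memLp_systemSum c _ 1).integrable le_rfl
    -- On a finite measure space `L_q` convergence implies `L_1` convergence, under which each
    -- coefficient is continuous.
    have h1 : Tendsto (fun N : ℕ => eLpNorm (systemSum φ c (Finset.range (N + 1)) - ⇑f) 1 m)
        atTop (𝓝 0) := by
      have h2 := ENNReal.Tendsto.mul_const (b := m Set.univ ^ (1 / (1 : ENNReal).toReal -
        1 / (ENNReal.ofReal q).toReal)) hconv (Or.inr ?_)
      · rw [zero_mul] at h2
        exact tendsto_of_tendsto_of_tendsto_of_le_of_le tendsto_const_nhds h2
          (fun _ => zero_le) fun N =>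
          eLpNorm_le_eLpNorm_mul_rpow_measure_univ hq1 ((hΦi N).sub hfi).1
      · refine ENNReal.rpow_ne_top_of_nonneg ?_ (measure_ne_top m _)
        rw [ENNReal.toReal_ofReal hq0.le, ENNReal.toReal_one, sub_nonneg]
        exact one_div_le_one_div_of_le one_pos (by linarith)
    have h3 : Tendsto (fun N : ℕ => M * ((n : ℝ) + 1) ^ τ *
        ∫ x, ‖(systemSum φ c (Finset.range (N + 1)) - ⇑f) x‖ ∂m) atTop (𝓝 0) := by
      have h4 := ((ENNReal.tendsto_toReal ENNReal.zero_ne_top).comp h1).const_mul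
        (M * ((n : ℝ) + 1) ^ τ)
      rw [ENNReal.toReal_zero, mul_zero] at h4
      refine h4.congr fun N => ?_
      rw [integral_norm_eq_lintegral_enorm ((hΦi N).sub hfi).1, ← eLpNorm_one_eq_lintegral_enorm]
      rfl
    -- For `N ≥ n` the coefficient of the partial sum is exactly `c n`, so a constant sequence tends
    -- to 0.
    have h5 : Tendsto (fun N : ℕ => c n - systemCoeff m φ f n) atTop (𝓝 0) := by
      refine squeeze_zero_norm' ?_ h3
      filter_upwards [eventually_ge_atTop n] with N hN
      rw [← h.systemCoeff_systemSum c (Finset.mem_range.2 (Nat.lt_succ_of_le hN)),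
        ← h.systemCoeff_sub (hΦi N) hfi]
      exact h.norm_systemCoeff_le ((hΦi N).sub hfi) n
    exact (sub_eq_zero.1 (tendsto_nhds_unique tendsto_const_nhds h5)).symm
  · rw [← Lp.norm_def]
    refine le_of_tendsto hf.norm (Eventually.of_forall fun N => ?_)
    rw [Lp.norm_toLp]
    refine (h.toReal_eLpNorm_systemSum_le hq c _).trans ?_
    gcongr
    · exact Finset.sum_nonneg fun n _ => hnn n
    · exact hc.sum_le_tsum _ fun n _ => hnn n

end IsGrowthSystem

/-! ### Application to the generalized Gegenbauer polynomials. -/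

theorem isGrowthSystem_orthoGegenbauer {lam mu : ℝ} (hlam : -(1 / 2) < lam) (hmu : 0 ≤ mu) :
    ∃ M, IsGrowthSystem (gegenbauerMeasure lam mu)
      (fun n t => (orthoGegenbauer lam mu n).eval t) M (max lam mu) := by
  obtain ⟨M, hM, hb⟩ := exists_abs_orthoGegenbauer_le hlam hmu
  refine ⟨M, fun n => (orthoGegenbauer lam mu n).continuous.measurable, fun n => ?_,
    integral_orthoGegenbauer_mul hlam hmu, hM.le, le_max_of_le_right hmu⟩
  filter_upwards [ae_mem_Icc_gegenbauerMeasure lam mu] with t ht using hb n t ht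

theorem theorem2 (lam mu : ℝ) (hlam : -(1 / 2) < lam) (hmu : 0 ≤ mu) :
    ∃ A : ℝ → ℝ,
      (∀ p : ℝ, 1 < p → p ≤ 2 → ∀ f : ℝ → ℂ,
        MemLp f (ENNReal.ofReal p) (gegenbauerMeasure lam mu) →
          Summable (hardyLittlewoodTerm lam mu p (gegenbauerFourierCoeff lam mu f)) ∧
          (∑' n, hardyLittlewoodTerm lam mu p (gegenbauerFourierCoeff lam mu f) n) ^ (1 / p) ≤
            A p * (eLpNorm f (ENNReal.ofReal p) (gegenbauerMeasure lam mu)).toReal) ∧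
      (∀ q : ℝ, 2 ≤ q → ∀ φ : ℕ → ℂ,
        Summable (hardyLittlewoodTerm lam mu q φ) →
          ∃ f : ℝ → ℂ,
            MemLp f (ENNReal.ofReal q) (gegenbauerMeasure lam mu) ∧
            Tendsto (fun N : ℕ =>
                eLpNorm (fun t => gegenbauerPartialSum lam mu φ N t - f t)
                  (ENNReal.ofReal q) (gegenbauerMeasure lam mu)) atTop (𝓝 0) ∧
            (∀ n : ℕ, gegenbauerFourierCoeff lam mu f n = φ n) ∧
            (eLpNorm f (ENNReal.ofReal q) (gegenbauerMeasure lam mu)).toReal ≤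
              A q.conjExponent * (∑' n, hardyLittlewoodTerm lam mu q φ n) ^ (1 / q)) := by
  have := isFiniteMeasure_gegenbauerMeasure hlam hmu
  obtain ⟨M, h⟩ := isGrowthSystem_orthoGegenbauer hlam hmu
  -- The abstract coefficients, partial sums and weighted terms unfold to the concrete ones with `τ
  -- = max lam mu`.
  exact ⟨fun p => paleyConst M p ^ (1 / p), fun p hp hp2 f hf => h.paley hp hp2 hf,
    fun q hq φ hφ => h.exists_limit_systemSum hq hφ⟩
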